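/- **Conventions.** For a $\sigma$-finite measure $\mu$, let $L^0(\mu)$ be the space of real measurable functions modulo equality $\mu$-a.e. A *Banach function space* over $\mu$ is a Banach space $X\subset L^0(\mu)$ (a linear subspace with a complete norm) such that $f\in L^0(\mu)$, $g\in X$, $|f|\le|g|$ a.e. imply $f\in X$ and $\|f\|_X\le\|g\|_X$. A set $A\subset L^0(\mu)$ is *saturated* if there is no measurable set of positive measure on which every $f\in A$ vanishes a.e. $X$ is *$\sigma$-order continuous* if $f_n\in X$, $f_n\downarrow0$ a.e. imply $\|f_n\|_X\to0$. For function spaces $X,Y$ over the same measure put $X^Y=\{h\in L^0:\ fh\in Y\ \text{for all } f\in X\}$ and, for $h\in X^Y$, $M_h\colon X\to Y$, $M_h(f)=hf$. The Köthe dual of a saturated $X$ is $X'=X^{L^1}$ with the norm $\|h\|_{X'}=\sup_{\|f\|_X\le1}\int|fh|$, and $X''=(X')'$. The product norm is $$\|h\|_{X\pi Y}=\inf\Big\{\sum_{n}\|f_n\|_X\|g_n\|_Y:\ f_n\in X,\ g_n\in Y,\ |h|\le\sum_n|f_ng_n|\ \text{a.e.},\ \sum_n\|f_n\|_X\|g_n\|_Y<\infty\Big\}.$$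 **Theorem 4.1.** Let $\mu,\nu$ be $\sigma$-finite measures, $X_1,X_2$ saturated Banach function spaces over $\mu$ and $Y_1,Y_2$ saturated Banach function spaces over $\nu$, and let $T\colon X_1\to Y_1$ and $S\colon X_2\to Y_2$ be nonzero continuous linear operators. Let $(\gamma_n)_{n\ge1}$ be a Schauder basis of $Y_1'$. Assume that $Y_2^{Y_1''}$ is saturated and that at least one of $Y_2$, $Y_1'$ is $\sigma$-order continuous. Let $h\in X_1^{X_2}$. Then the following are equivalent: (a) $T$ factors strongly through $S$ and $M_h$: there is $g\in Y_2^{Y_1''}$ with $T(x)=g\,S(hx)$ for all $x\in X_1$. (b) There is a constant $C>0$ such that for all $n\in\mathbb N$ and all $x_1,\dots,x_n\in X_1$ $$\sum_{i=1}^n\int T(x_i)\gamma_i\,d\nu\le C\,\Big\|\sum_{i=1}^nS(hx_i)\gamma_i\Big\|_{Y_2\pi Y_1'}.$$ Suppose moreover that the functions $\gamma_n$ have pairwise disjoint supports (up to null sets), and consider the condition (c) There is a constant $C>0$ such that for all $n\ge1$ and all $x\in X_1$ $$\int T(x)\gamma_n\,d\nu\le C\int|S(hx)\gamma_n|\,d\nu.$$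 If $Y_2\subset Y_1''$, then (c) implies (a) and (b). If $Y_2^{Y_1''}=L^\infty(\nu)$ as sets (which forces $Y_2\subset Y_1''$), then (c) is equivalent to (a) and to (b). -/

import Mathlib

open MeasureTheory Filter Topology
open scoped ENNReal

noncomputable section

/-- A Banach function space over `μ`: a linear subspace of `L⁰(μ)` (measurable real functions modulo
equality `μ`-a.e.) with a complete norm, such that `|f| ≤ |g|` a.e. with `g` in the space implies
that `f` is in the space and `‖f‖ ≤ ‖g‖`. -/
structure BanachFunctionSpace {Ω : Type*} [MeasurableSpace Ω] (μ : Measure Ω) where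
  carrier : Submodule ℝ (Ω →ₘ[μ] ℝ)
  norm : AddGroupNorm carrier
  norm_smul : ∀ (c : ℝ) (f : carrier), norm (c • f) = |c| * norm f
  solid : ∀ (f : Ω →ₘ[μ] ℝ) (g : carrier), (∀ᵐ ω ∂μ, |f ω| ≤ |(g : Ω →ₘ[μ] ℝ) ω|) →
    ∃ hf : f ∈ carrier, norm ⟨f, hf⟩ ≤ norm g
  complete : letI := norm.toNormedAddCommGroup; CompleteSpace carrier

namespace BanachFunctionSpace

instance {Ω : Type*} [MeasurableSpace Ω] {μ : Measure Ω} :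
    CoeSort (BanachFunctionSpace μ) (Type _) := ⟨fun X => X.carrier⟩

instance {Ω : Type*} [MeasurableSpace Ω] {μ : Measure Ω} (X : BanachFunctionSpace μ) :
    NormedAddCommGroup X := X.norm.toNormedAddCommGroup

instance {Ω : Type*} [MeasurableSpace Ω] {μ : Measure Ω} (X : BanachFunctionSpace μ) :
    NormedSpace ℝ X where
  norm_smul_le c f := (X.norm_smul c f).le

instance {Ω : Type*} [MeasurableSpace Ω] {μ : Measure Ω} (X : BanachFunctionSpace μ) :
    CompleteSpace X := X.complete

/-- The space of all `h ∈ L⁰(μ)` such that `f h ∈ B` for all `f ∈ A`. For Banach function spaces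
`X`, `Y` this is the `Y`-dual space `X^Y` of `X`. -/
def multSpace {Ω : Type*} [MeasurableSpace Ω] {μ : Measure Ω} (A B : Submodule ℝ (Ω →ₘ[μ] ℝ)) :
    Submodule ℝ (Ω →ₘ[μ] ℝ) where
  carrier := {h | ∀ f ∈ A, f * h ∈ B}
  add_mem' {a b} ha hb f hf := by
    have : f * (a + b) = f * a + f * b := by
      apply AEEqFun.ext
      filter_upwards [AEEqFun.coeFn_mul f (a + b), AEEqFun.coeFn_add a b,
        AEEqFun.coeFn_add (f * a) (f * b), AEEqFun.coeFn_mul f a, AEEqFun.coeFn_mul f b]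
        with ω h1 h2 h3 h4 h5
      simp only [h1, h2, h3, h4, h5, Pi.mul_apply, Pi.add_apply, mul_add]
    rw [this]
    exact B.add_mem (ha f hf) (hb f hf)
  zero_mem' f _ := by
    have : f * (0 : Ω →ₘ[μ] ℝ) = 0 := by
      apply AEEqFun.ext
      filter_upwards [AEEqFun.coeFn_mul f 0, AEEqFun.coeFn_zero (α := Ω) (μ := μ) (β := ℝ)]
        with ω h1 h2
      simp [h1, h2]
    rw [this]
    exact B.zero_mem
  smul_mem' c h hh f hf := by
    have : f * (c • h) = c • (f * h) := by
      apply AEEqFun.ext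
      filter_upwards [AEEqFun.coeFn_mul f (c • h), AEEqFun.coeFn_smul c h,
        AEEqFun.coeFn_smul c (f * h), AEEqFun.coeFn_mul f h] with ω h1 h2 h3 h4
      simp only [h1, h2, h3, h4, Pi.mul_apply, Pi.smul_apply, smul_eq_mul]
      ring
    rw [this]
    exact B.smul_mem c (hh f hf)

/-- The elements of the Köthe dual: all `h` with `f h ∈ L¹(μ)` for every `f ∈ A`. -/
def kotheSet {Ω : Type*} [MeasurableSpace Ω] {μ : Measure Ω} (A : Submodule ℝ (Ω →ₘ[μ] ℝ)) :
    Submodule ℝ (Ω →ₘ[μ] ℝ) :=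
  multSpace A (Lp.LpSubmodule ℝ ℝ 1 μ)

/-- `A` is saturated: there is no measurable set of positive measure on which every `f ∈ A`
vanishes a.e. -/
def Saturated {Ω : Type*} [MeasurableSpace Ω] {μ : Measure Ω} (A : Submodule ℝ (Ω →ₘ[μ] ℝ)) :
    Prop :=
  ¬ ∃ s : Set Ω, MeasurableSet s ∧ 0 < μ s ∧ ∀ f ∈ A, ∀ᵐ ω ∂μ, ω ∈ s → f ω = 0

/-- The elements of the Köthe bidual `X''`. -/
def kotheBidual {Ω : Type*} [MeasurableSpace Ω] {μ : Measure Ω} (X : BanachFunctionSpace μ) :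
    Submodule ℝ (Ω →ₘ[μ] ℝ) :=
  kotheSet (kotheSet X.carrier)

/-- `X` is `σ`-order continuous: `fₙ ↓ 0` a.e. implies `‖fₙ‖ → 0`. -/
def SigmaOrderContinuous {Ω : Type*} [MeasurableSpace Ω] {μ : Measure Ω}
    (X : BanachFunctionSpace μ) : Prop :=
  ∀ f : ℕ → X,
    (∀ᵐ ω ∂μ, Antitone (fun n => (f n : Ω →ₘ[μ] ℝ) ω) ∧
      Tendsto (fun n => (f n : Ω →ₘ[μ] ℝ) ω) atTop (𝓝 0)) →
    Tendsto (fun n => ‖f n‖) atTop (𝓝 0)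

section KotheDual

theorem mem_kotheSet {Ω : Type*} [MeasurableSpace Ω] {μ : Measure Ω}
    {A : Submodule ℝ (Ω →ₘ[μ] ℝ)} {h : Ω →ₘ[μ] ℝ} :
    h ∈ kotheSet A ↔ ∀ f ∈ A, Integrable (fun ω => f ω * h ω) μ := by
  have key : ∀ f : Ω →ₘ[μ] ℝ,
      f * h ∈ Lp.LpSubmodule ℝ ℝ 1 μ ↔ Integrable (fun ω => f ω * h ω) μ := by
    intro f
    have h1 : f * h ∈ Lp.LpSubmodule ℝ ℝ 1 μ ↔ Integrable (f * h : Ω →ₘ[μ] ℝ) μ := by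
      rw [← memLp_one_iff_integrable]
      exact Lp.mem_Lp_iff_memLp
    rw [h1]
    exact integrable_congr (AEEqFun.coeFn_mul f h)
  exact forall₂_congr fun f _ => key f

theorem ae_le_of_tendsto {Ω : Type*} [MeasurableSpace Ω] {μ : Measure Ω} (X : BanachFunctionSpace μ)
    (a v : X) (u : ℕ → X) (hu : Tendsto u atTop (𝓝 v))
    (ha : ∀ᶠ n in atTop, ∀ᵐ ω ∂μ, (a : Ω →ₘ[μ] ℝ) ω ≤ (u n : Ω →ₘ[μ] ℝ) ω) :
    ∀ᵐ ω ∂μ, (a : Ω →ₘ[μ] ℝ) ω ≤ (v : Ω →ₘ[μ] ℝ) ω := by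
  let w : Ω →ₘ[μ] ℝ := ((a - v : X) : Ω →ₘ[μ] ℝ) ⊔ 0
  have hw : ∀ᵐ ω ∂μ, w ω = max ((a : Ω →ₘ[μ] ℝ) ω - (v : Ω →ₘ[μ] ℝ) ω) 0 := by
    filter_upwards [AEEqFun.coeFn_sup ((a - v : X) : Ω →ₘ[μ] ℝ) 0,
      AEEqFun.coeFn_sub (a : Ω →ₘ[μ] ℝ) v, AEEqFun.coeFn_zero (α := Ω) (μ := μ) (β := ℝ)]
      with ω h1 h2 h3
    have h2' : ((a - v : X) : Ω →ₘ[μ] ℝ) ω = (a : Ω →ₘ[μ] ℝ) ω - (v : Ω →ₘ[μ] ℝ) ω := h2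
    rw [h1, h2', h3]; rfl
  have hs : ∀ n, (∀ᵐ ω ∂μ, (a : Ω →ₘ[μ] ℝ) ω ≤ (u n : Ω →ₘ[μ] ℝ) ω) →
      ∃ hm : w ∈ X.carrier, X.norm ⟨w, hm⟩ ≤ X.norm (u n - v) := by
    intro n hn
    apply X.solid
    filter_upwards [hw, hn, AEEqFun.coeFn_sub (u n : Ω →ₘ[μ] ℝ) v] with ω h1 h2 h3
    have h3' : ((u n - v : X) : Ω →ₘ[μ] ℝ) ω = (u n : Ω →ₘ[μ] ℝ) ω - (v : Ω →ₘ[μ] ℝ) ω := h3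
    rw [h1, h3', abs_of_nonneg (le_max_right _ _)]
    exact max_le ((sub_le_sub_right h2 _).trans (le_abs_self _)) (abs_nonneg _)
  obtain ⟨N, hN⟩ := eventually_atTop.1 ha
  obtain ⟨hm, -⟩ := hs N (hN N le_rfl)
  have hle : ∀ n ≥ N, X.norm ⟨w, hm⟩ ≤ ‖u n - v‖ := fun n hn => (hs n (hN n hn)).2
  have h0 : X.norm ⟨w, hm⟩ ≤ 0 :=
    ge_of_tendsto (tendsto_iff_norm_sub_tendsto_zero.1 hu)
      (eventually_atTop.2 ⟨N, hle⟩)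
  have h1 : (⟨w, hm⟩ : X) = 0 := norm_le_zero_iff.1 h0
  have h2 : w = 0 := congrArg Subtype.val h1
  filter_upwards [hw, AEEqFun.coeFn_zero (α := Ω) (μ := μ) (β := ℝ)] with ω h3 h4
  rw [h2, h4] at h3
  have h5 : (0 : ℝ) = max ((a : Ω →ₘ[μ] ℝ) ω - (v : Ω →ₘ[μ] ℝ) ω) 0 := h3
  have := le_max_left ((a : Ω →ₘ[μ] ℝ) ω - (v : Ω →ₘ[μ] ℝ) ω) 0
  linarith

/-- Every `h` in the Köthe dual defines a bounded multiplication operator `X → L¹(μ)`. -/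
theorem exists_bound {Ω : Type*} [MeasurableSpace Ω] {μ : Measure Ω} (X : BanachFunctionSpace μ)
    {h : Ω →ₘ[μ] ℝ} (hh : h ∈ kotheSet X.carrier) :
    ∃ M : ℝ, ∀ f : X, ∫ ω, |(f : Ω →ₘ[μ] ℝ) ω * h ω| ∂μ ≤ M * ‖f‖ := by
  rw [mem_kotheSet] at hh
  by_contra! hcon
  choose f hf using fun n : ℕ => hcon (4 ^ n)
  have hpos : ∀ n, 0 < ‖f n‖ := by
    intro n
    rw [norm_pos_iff]
    intro h0
    have h1 := hf n
    rw [h0, norm_zero, mul_zero] at h1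
    have h2 : ∫ ω, |((0 : X) : Ω →ₘ[μ] ℝ) ω * h ω| ∂μ = 0 := by
      apply integral_eq_zero_of_ae
      filter_upwards [AEEqFun.coeFn_zero (α := Ω) (μ := μ) (β := ℝ)] with ω h4
      have h5 : ((0 : X) : Ω →ₘ[μ] ℝ) ω = 0 := h4
      change |((0 : X) : Ω →ₘ[μ] ℝ) ω * h ω| = 0
      rw [h5, zero_mul, abs_zero]
    linarith
  have habs : ∀ n, ∃ hm : |(f n : Ω →ₘ[μ] ℝ)| ∈ X.carrier,
      X.norm ⟨_, hm⟩ ≤ X.norm (f n) := by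
    intro n
    apply X.solid
    filter_upwards [AEEqFun.coeFn_abs (f n : Ω →ₘ[μ] ℝ)] with ω h1
    rw [h1, abs_abs]
  choose hm hn using habs
  let u : ℕ → X := fun n => ((2 : ℝ)⁻¹ ^ n * ‖f n‖⁻¹) • (⟨_, hm n⟩ : X)
  have hu : ∀ n, ∀ᵐ ω ∂μ, (u n : Ω →ₘ[μ] ℝ) ω
      = ((2 : ℝ)⁻¹ ^ n * ‖f n‖⁻¹) * |(f n : Ω →ₘ[μ] ℝ) ω| := by
    intro n
    filter_upwards [AEEqFun.coeFn_abs (f n : Ω →ₘ[μ] ℝ),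
      AEEqFun.coeFn_smul ((2 : ℝ)⁻¹ ^ n * ‖f n‖⁻¹) |(f n : Ω →ₘ[μ] ℝ)|] with ω h1 h2
    have h2' : (u n : Ω →ₘ[μ] ℝ) ω = _ := h2
    rw [h2', Pi.smul_apply, h1, smul_eq_mul]
  have hc : ∀ n, 0 ≤ (2 : ℝ)⁻¹ ^ n * ‖f n‖⁻¹ := fun n => by positivity
  have hu0 : ∀ n, ∀ᵐ ω ∂μ, 0 ≤ (u n : Ω →ₘ[μ] ℝ) ω := by
    intro n
    filter_upwards [hu n] with ω h1
    rw [h1]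
    exact mul_nonneg (hc n) (abs_nonneg _)
  have hunorm : ∀ n, ‖u n‖ ≤ (2 : ℝ)⁻¹ ^ n := by
    intro n
    have h1 : ‖u n‖ = ‖(2 : ℝ)⁻¹ ^ n * ‖f n‖⁻¹‖ * ‖(⟨_, hm n⟩ : X)‖ :=
      _root_.norm_smul _ _
    rw [h1, Real.norm_of_nonneg (hc n), mul_assoc]
    have h2 : ‖f n‖⁻¹ * ‖(⟨_, hm n⟩ : X)‖ ≤ ‖f n‖⁻¹ * ‖f n‖ :=
      mul_le_mul_of_nonneg_left (hn n) (inv_nonneg.2 (norm_nonneg _))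
    rw [inv_mul_cancel₀ (hpos n).ne'] at h2
    calc _ ≤ (2 : ℝ)⁻¹ ^ n * 1 := mul_le_mul_of_nonneg_left h2 (by positivity)
      _ = _ := mul_one _
  have hsum : Summable u :=
    Summable.of_norm_bounded (summable_geometric_of_lt_one (by norm_num) (by norm_num)) hunorm
  have htend := hsum.hasSum.tendsto_sum_nat
  set v : X := ∑' n, u n
  have hpart : ∀ N, ∀ᵐ ω ∂μ, ((∑ i ∈ Finset.range N, u i : X) : Ω →ₘ[μ] ℝ) ω
      = ∑ i ∈ Finset.range N, (u i : Ω →ₘ[μ] ℝ) ω := by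
    intro N
    induction N with
    | zero =>
      filter_upwards [AEEqFun.coeFn_zero (α := Ω) (μ := μ) (β := ℝ)] with ω h4
      simpa using h4
    | succ N ih =>
      have := AEEqFun.coeFn_add ((∑ i ∈ Finset.range N, u i : X) : Ω →ₘ[μ] ℝ) (u N)
      filter_upwards [ih, this] with ω h1 h2
      rw [Finset.sum_range_succ, Finset.sum_range_succ, ← h1]
      exact h2
  have hdom : ∀ n, ∀ᵐ ω ∂μ, (u n : Ω →ₘ[μ] ℝ) ω ≤ (v : Ω →ₘ[μ] ℝ) ω := by
    intro n
    apply X.ae_le_of_tendsto (u n) v _ htend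
    filter_upwards [eventually_gt_atTop n] with N hN
    filter_upwards [hpart N, ae_all_iff.2 hu0] with ω h1 h2
    rw [h1]
    exact Finset.single_le_sum (f := fun i => (u i : Ω →ₘ[μ] ℝ) ω) (fun i _ => h2 i)
      (Finset.mem_range.2 hN)
  have hv := (hh v v.2).abs
  have hbig : ∀ n : ℕ, (2 : ℝ) ^ n ≤ ∫ ω, |(v : Ω →ₘ[μ] ℝ) ω * h ω| ∂μ := by
    intro n
    have h1 : ∫ ω, |(u n : Ω →ₘ[μ] ℝ) ω * h ω| ∂μ ≤ ∫ ω, |(v : Ω →ₘ[μ] ℝ) ω * h ω| ∂μ := by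
      apply integral_mono_ae (hh (u n) (u n).2).abs hv
      filter_upwards [hdom n, hu0 n] with ω h1 h2
      simp only [abs_mul]
      gcongr
    refine le_trans ?_ h1
    have h2 : ∫ ω, |(u n : Ω →ₘ[μ] ℝ) ω * h ω| ∂μ
        = ((2 : ℝ)⁻¹ ^ n * ‖f n‖⁻¹) * ∫ ω, |(f n : Ω →ₘ[μ] ℝ) ω * h ω| ∂μ := by
      rw [← integral_const_mul]
      apply integral_congr_ae
      filter_upwards [hu n] with ω h3
      rw [h3, abs_mul, abs_mul, abs_of_nonneg (hc n), abs_abs, abs_mul, mul_assoc]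
    rw [h2]
    have h3 : ((2 : ℝ)⁻¹ ^ n * ‖f n‖⁻¹) * (4 ^ n * ‖f n‖) = 2 ^ n := by
      have h4 : (2 : ℝ)⁻¹ ^ n * 4 ^ n = 2 ^ n := by
        rw [← mul_pow]; norm_num
      have h5 := inv_mul_cancel₀ (hpos n).ne'
      calc _ = ((2 : ℝ)⁻¹ ^ n * 4 ^ n) * (‖f n‖⁻¹ * ‖f n‖) := by ring
        _ = _ := by rw [h4, h5, mul_one]
    rw [← h3]
    exact mul_le_mul_of_nonneg_left (hf n).le (hc n)
  obtain ⟨n, hn'⟩ := pow_unbounded_of_one_lt (∫ ω, |(v : Ω →ₘ[μ] ℝ) ω * h ω| ∂μ)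
    (one_lt_two : (1 : ℝ) < 2)
  exact absurd (hbig n) (not_le.2 hn')

/-- The norm of the Köthe dual, `‖h‖ = sup {∫ |f h| dμ : f ∈ X, ‖f‖ ≤ 1}`. -/
def kotheNorm {Ω : Type*} [MeasurableSpace Ω] {μ : Measure Ω} (X : BanachFunctionSpace μ)
    (h : Ω →ₘ[μ] ℝ) : ℝ :=
  ⨆ f : {f : X // ‖f‖ ≤ 1}, ∫ ω, |((f : X) : Ω →ₘ[μ] ℝ) ω * h ω| ∂μ

theorem bddAbove_kothe {Ω : Type*} [MeasurableSpace Ω] {μ : Measure Ω} (X : BanachFunctionSpace μ)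
    {h : Ω →ₘ[μ] ℝ} (hh : h ∈ kotheSet X.carrier) :
    BddAbove (Set.range fun f : {f : X // ‖f‖ ≤ 1} =>
      ∫ ω, |((f : X) : Ω →ₘ[μ] ℝ) ω * h ω| ∂μ) := by
  obtain ⟨M, hM⟩ := X.exists_bound hh
  refine ⟨|M|, ?_⟩
  rintro _ ⟨⟨f, hf⟩, rfl⟩
  calc _ ≤ M * ‖f‖ := hM f
    _ ≤ |M| * ‖f‖ := by gcongr; exact le_abs_self M
    _ ≤ |M| * 1 := by gcongr
    _ = |M| := mul_one _

theorem kotheNorm_nonneg {Ω : Type*} [MeasurableSpace Ω] {μ : Measure Ω}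
    (X : BanachFunctionSpace μ) (h : Ω →ₘ[μ] ℝ) : 0 ≤ X.kotheNorm h :=
  Real.iSup_nonneg fun _ => integral_nonneg fun _ => abs_nonneg _

theorem kotheNorm_le {Ω : Type*} [MeasurableSpace Ω] {μ : Measure Ω} (X : BanachFunctionSpace μ)
    {h : Ω →ₘ[μ] ℝ} {M : ℝ}
    (hM : ∀ f : X, ‖f‖ ≤ 1 → ∫ ω, |(f : Ω →ₘ[μ] ℝ) ω * h ω| ∂μ ≤ M) : X.kotheNorm h ≤ M := by
  have : Nonempty {f : X // ‖f‖ ≤ 1} := ⟨⟨0, by simp⟩⟩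
  exact ciSup_le fun f => hM f f.2

theorem integral_le_kotheNorm {Ω : Type*} [MeasurableSpace Ω] {μ : Measure Ω}
    (X : BanachFunctionSpace μ) {h : Ω →ₘ[μ] ℝ} (hh : h ∈ kotheSet X.carrier) (f : X) :
    ∫ ω, |(f : Ω →ₘ[μ] ℝ) ω * h ω| ∂μ ≤ ‖f‖ * X.kotheNorm h := by
  rcases eq_or_ne f 0 with rfl | hf
  · rw [norm_zero, zero_mul]
    apply le_of_eq
    apply integral_eq_zero_of_ae
    filter_upwards [AEEqFun.coeFn_zero (α := Ω) (μ := μ) (β := ℝ)] with ω h4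
    have h5 : ((0 : X) : Ω →ₘ[μ] ℝ) ω = 0 := h4
    change |((0 : X) : Ω →ₘ[μ] ℝ) ω * h ω| = 0
    rw [h5, zero_mul, abs_zero]
  · have hpos := norm_pos_iff.2 hf
    have h1 : ‖‖f‖⁻¹ • f‖ ≤ 1 := by
      rw [_root_.norm_smul, norm_inv, norm_norm, inv_mul_cancel₀ hpos.ne']
    have h2 := le_ciSup (X.bddAbove_kothe hh) ⟨‖f‖⁻¹ • f, h1⟩
    have h3 : ∫ ω, |((‖f‖⁻¹ • f : X) : Ω →ₘ[μ] ℝ) ω * h ω| ∂μ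
        = ‖f‖⁻¹ * ∫ ω, |(f : Ω →ₘ[μ] ℝ) ω * h ω| ∂μ := by
      rw [← integral_const_mul]
      apply integral_congr_ae
      filter_upwards [AEEqFun.coeFn_smul ‖f‖⁻¹ (f : Ω →ₘ[μ] ℝ)] with ω h4
      have h5 : ((‖f‖⁻¹ • f : X) : Ω →ₘ[μ] ℝ) ω = ‖f‖⁻¹ * (f : Ω →ₘ[μ] ℝ) ω := h4
      rw [h5, mul_assoc, abs_mul, abs_of_nonneg (inv_nonneg.2 hpos.le)]
    have h4 : ‖f‖⁻¹ * ∫ ω, |(f : Ω →ₘ[μ] ℝ) ω * h ω| ∂μ ≤ X.kotheNorm h := h3 ▸ h2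
    rwa [inv_mul_le_iff₀ hpos] at h4

theorem eq_zero_of_kotheNorm {Ω : Type*} [MeasurableSpace Ω] {μ : Measure Ω}
    (X : BanachFunctionSpace μ) (hX : Saturated X.carrier) {h : Ω →ₘ[μ] ℝ}
    (hh : h ∈ kotheSet X.carrier) (h0 : X.kotheNorm h = 0) : h = 0 := by
  by_contra hne
  apply hX
  refine ⟨{ω | h ω ≠ 0}, ?_, ?_, ?_⟩
  · exact (AEEqFun.measurable h) (measurableSet_singleton 0).compl
  · rw [pos_iff_ne_zero]
    intro h1
    apply hne
    apply AEEqFun.ext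
    filter_upwards [AEEqFun.coeFn_zero (α := Ω) (μ := μ) (β := ℝ), measure_eq_zero_iff_ae_notMem.1 h1]
      with ω h2 h3
    rw [h2]
    simpa using h3
  · intro f hf
    have h1 := X.integral_le_kotheNorm hh ⟨f, hf⟩
    rw [h0, mul_zero] at h1
    have h2 : ∫ ω, |f ω * h ω| ∂μ = 0 :=
      le_antisymm h1 (integral_nonneg fun _ => abs_nonneg _)
    rw [integral_eq_zero_iff_of_nonneg (fun _ => abs_nonneg _) (mem_kotheSet.1 hh f hf).abs] at h2
    filter_upwards [h2] with ω h3 h4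
    have h5 : |f ω * h ω| = 0 := h3
    exact (mul_eq_zero.1 (abs_eq_zero.1 h5)).resolve_right h4

theorem lintegral_tsum_le {Ω : Type*} [MeasurableSpace Ω] {μ : Measure Ω}
    (X : BanachFunctionSpace μ) (u : ℕ → kotheSet X.carrier)
    (hu : Summable fun n => X.kotheNorm (u n)) (f : X) :
    ∫⁻ ω, ‖(f : Ω →ₘ[μ] ℝ) ω‖ₑ * ∑' n, ‖(u n : Ω →ₘ[μ] ℝ) ω‖ₑ ∂μ
      ≤ ENNReal.ofReal (‖f‖ * ∑' n, X.kotheNorm (u n)) := by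
  have h1 : ∀ n, ∫⁻ ω, ‖(f : Ω →ₘ[μ] ℝ) ω‖ₑ * ‖(u n : Ω →ₘ[μ] ℝ) ω‖ₑ ∂μ
      ≤ ENNReal.ofReal (‖f‖ * X.kotheNorm (u n)) := by
    intro n
    refine le_trans (le_of_eq ?_) (ENNReal.ofReal_le_ofReal (X.integral_le_kotheNorm (u n).2 f))
    have h2 := ofReal_integral_norm_eq_lintegral_enorm (mem_kotheSet.1 (u n).2 f f.2)
    simp only [Real.norm_eq_abs] at h2
    rw [h2]
    simp only [enorm_mul]
  simp_rw [← ENNReal.tsum_mul_left]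
  rw [lintegral_tsum]
  · rw [← tsum_mul_left, ENNReal.ofReal_tsum_of_nonneg
      (fun n => mul_nonneg (norm_nonneg _) (X.kotheNorm_nonneg _)) (hu.mul_left _)]
    exact ENNReal.tsum_le_tsum h1
  · intro n
    exact ((AEEqFun.measurable _).enorm.mul (AEEqFun.measurable _).enorm).aemeasurable

theorem kothe_complete {Ω : Type*} [MeasurableSpace Ω] {μ : Measure Ω} (X : BanachFunctionSpace μ)
    (hX : Saturated X.carrier) (u : ℕ → kotheSet X.carrier)
    (hu : Summable fun n => X.kotheNorm (u n)) :
    ∃ h : kotheSet X.carrier,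
      Tendsto (fun N => X.kotheNorm ((∑ i ∈ Finset.range N, u i - h : kotheSet X.carrier) :
        Ω →ₘ[μ] ℝ)) atTop (𝓝 0) := by
  have hmK : ∀ n, Measurable fun ω => ‖(u n : Ω →ₘ[μ] ℝ) ω‖ₑ :=
    fun n => (AEEqFun.measurable _).enorm
  have hfin : ∀ᵐ ω ∂μ, ∑' n, ‖(u n : Ω →ₘ[μ] ℝ) ω‖ₑ ≠ ∞ := by
    by_contra hne
    apply hX
    refine ⟨{ω | ∑' n, ‖(u n : Ω →ₘ[μ] ℝ) ω‖ₑ = ∞},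
      (Measurable.tsum hmK) (measurableSet_singleton ∞), ?_, ?_⟩
    · rw [pos_iff_ne_zero]
      intro h0
      exact hne (measure_eq_zero_iff_ae_notMem.1 h0)
    · intro f hf
      have h1 := X.lintegral_tsum_le u hu ⟨f, hf⟩
      have h2 := ae_lt_top ((AEEqFun.measurable f).enorm.mul (Measurable.tsum hmK))
        (ne_top_of_le_ne_top ENNReal.ofReal_ne_top h1)
      filter_upwards [h2] with ω h3 h4
      have h5 : ∑' n, ‖(u n : Ω →ₘ[μ] ℝ) ω‖ₑ = ∞ := h4
      by_contra h6
      rw [Pi.mul_apply, h5, ENNReal.mul_top (by simpa using h6)] at h3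
      exact lt_irrefl _ h3
  have hsumm : ∀ᵐ ω ∂μ, Summable fun n => (u n : Ω →ₘ[μ] ℝ) ω := by
    filter_upwards [hfin] with ω h1
    apply Summable.of_norm
    have h2 := ENNReal.summable_toReal h1
    simpa using h2
  have hHm : AEStronglyMeasurable (fun ω => ∑' n, (u n : Ω →ₘ[μ] ℝ) ω) μ := by
    refine aestronglyMeasurable_of_tendsto_ae atTop
      (f := fun N ω => ∑ i ∈ Finset.range N, (u i : Ω →ₘ[μ] ℝ) ω) (fun N => ?_) ?_
    · exact Finset.aestronglyMeasurable_fun_sum _ fun i _ => AEEqFun.aestronglyMeasurable _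
    · filter_upwards [hsumm] with ω h1
      exact h1.hasSum.tendsto_sum_nat
  let h : Ω →ₘ[μ] ℝ := AEEqFun.mk _ hHm
  have hh : ∀ᵐ ω ∂μ, h ω = ∑' n, (u n : Ω →ₘ[μ] ℝ) ω := AEEqFun.coeFn_mk _ hHm
  have hpart : ∀ N, ∀ᵐ ω ∂μ, ((∑ i ∈ Finset.range N, u i : kotheSet X.carrier) : Ω →ₘ[μ] ℝ) ω
      = ∑ i ∈ Finset.range N, (u i : Ω →ₘ[μ] ℝ) ω := by
    intro N
    induction N with
    | zero =>
      filter_upwards [AEEqFun.coeFn_zero (α := Ω) (μ := μ) (β := ℝ)] with ω h4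
      simpa using h4
    | succ N ih =>
      have := AEEqFun.coeFn_add
        ((∑ i ∈ Finset.range N, u i : kotheSet X.carrier) : Ω →ₘ[μ] ℝ) (u N)
      filter_upwards [ih, this] with ω h1 h2
      rw [Finset.sum_range_succ, Finset.sum_range_succ, ← h1]
      exact h2
  have hmem : h ∈ kotheSet X.carrier := by
    rw [mem_kotheSet]
    intro f hf
    refine ⟨((AEEqFun.measurable f).mul (AEEqFun.measurable h)).aestronglyMeasurable, ?_⟩
    refine lt_of_le_of_lt ?_
      (lt_of_le_of_lt (X.lintegral_tsum_le u hu ⟨f, hf⟩) ENNReal.ofReal_lt_top)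
    apply lintegral_mono_ae
    filter_upwards [hh, hsumm] with ω h1 h2
    rw [enorm_mul, h1]
    gcongr
    exact enorm_tsum_le_tsum_enorm
  refine ⟨⟨h, hmem⟩, ?_⟩
  refine squeeze_zero (fun N => X.kotheNorm_nonneg _) (fun N => ?_)
    (tendsto_sum_nat_add fun n => X.kotheNorm (u n))
  apply X.kotheNorm_le
  intro f hf
  have hN : Summable fun n => X.kotheNorm (u (n + N)) := (summable_nat_add_iff N).2 hu
  have hS0 : 0 ≤ ∑' n, X.kotheNorm (u (n + N)) := tsum_nonneg fun n => X.kotheNorm_nonneg _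
  have h1 := X.lintegral_tsum_le (fun n => u (n + N)) hN f
  have hd := (∑ i ∈ Finset.range N, u i - ⟨h, hmem⟩ : kotheSet X.carrier).2
  rw [mem_kotheSet] at hd
  have h2 := ofReal_integral_norm_eq_lintegral_enorm (hd f f.2)
  simp only [Real.norm_eq_abs] at h2
  refine (ENNReal.ofReal_le_ofReal_iff hS0).1 ?_
  rw [h2]
  calc _ ≤ ∫⁻ ω, ‖(f : Ω →ₘ[μ] ℝ) ω‖ₑ * ∑' n, ‖(u (n + N) : Ω →ₘ[μ] ℝ) ω‖ₑ ∂μ := by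
        apply lintegral_mono_ae
        filter_upwards [hh, hsumm, hpart N, AEEqFun.coeFn_sub
          ((∑ i ∈ Finset.range N, u i : kotheSet X.carrier) : Ω →ₘ[μ] ℝ) h] with ω h3 h4 h5 h6
        have h7 : ((∑ i ∈ Finset.range N, u i - ⟨h, hmem⟩ : kotheSet X.carrier) : Ω →ₘ[μ] ℝ) ω
            = - ∑' n, (u (n + N) : Ω →ₘ[μ] ℝ) ω := by
          have h8 := h4.sum_add_tsum_nat_add N
          have h9 : ((∑ i ∈ Finset.range N, u i - ⟨h, hmem⟩ : kotheSet X.carrier) : Ω →ₘ[μ] ℝ) ω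
            = _ := h6
          rw [h9, Pi.sub_apply, h5, h3]
          linarith
        rw [enorm_mul, h7, enorm_neg]
        gcongr
        exact enorm_tsum_le_tsum_enorm
    _ ≤ _ := h1
    _ ≤ _ := by
        apply ENNReal.ofReal_le_ofReal
        calc _ ≤ 1 * ∑' n, X.kotheNorm (u (n + N)) := by gcongr
          _ = _ := one_mul _

theorem kotheNorm_solid {Ω : Type*} [MeasurableSpace Ω] {μ : Measure Ω}
    (X : BanachFunctionSpace μ) {h k : Ω →ₘ[μ] ℝ} (hk : k ∈ kotheSet X.carrier)
    (hhk : ∀ᵐ ω ∂μ, |h ω| ≤ |k ω|) :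
    h ∈ kotheSet X.carrier ∧ X.kotheNorm h ≤ X.kotheNorm k := by
  have hmem : h ∈ kotheSet X.carrier := by
    rw [mem_kotheSet] at hk ⊢
    intro f hf
    refine (hk f hf).mono ((AEEqFun.measurable f).mul (AEEqFun.measurable h)).aestronglyMeasurable
      ?_
    filter_upwards [hhk] with ω h1
    rw [norm_mul, norm_mul]
    exact mul_le_mul_of_nonneg_left h1 (norm_nonneg _)
  refine ⟨hmem, X.kotheNorm_le fun f hf => ?_⟩
  refine le_trans ?_ (le_ciSup (X.bddAbove_kothe hk) ⟨f, hf⟩)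
  apply integral_mono_ae (mem_kotheSet.1 hmem f f.2).abs (mem_kotheSet.1 hk f f.2).abs
  filter_upwards [hhk] with ω h1
  simp only [abs_mul]
  gcongr

theorem kotheNorm_smul {Ω : Type*} [MeasurableSpace Ω] {μ : Measure Ω}
    (X : BanachFunctionSpace μ) (c : ℝ) (h : Ω →ₘ[μ] ℝ) :
    X.kotheNorm (c • h) = |c| * X.kotheNorm h := by
  unfold kotheNorm
  rw [Real.mul_iSup_of_nonneg (abs_nonneg c)]
  congr 1
  funext f
  rw [← integral_const_mul]
  apply integral_congr_ae
  filter_upwards [AEEqFun.coeFn_smul c h] with ω h1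
  rw [h1, Pi.smul_apply, smul_eq_mul, ← abs_mul]
  congr 1
  ring

/-- `kotheNorm` as a norm on the elements of the Köthe dual. -/
def kotheAddGroupNorm {Ω : Type*} [MeasurableSpace Ω] {μ : Measure Ω} (X : BanachFunctionSpace μ)
    (hX : Saturated X.carrier) : AddGroupNorm (kotheSet X.carrier) where
  toFun := fun h => X.kotheNorm h
  map_zero' := by
    have := X.kotheNorm_smul 0 0
    simpa using this
  add_le' := fun h k => by
    apply X.kotheNorm_le
    intro f hf
    have h1 := mem_kotheSet.1 h.2 f f.2
    have h2 := mem_kotheSet.1 k.2 f f.2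
    calc ∫ ω, |(f : Ω →ₘ[μ] ℝ) ω * ((h + k : kotheSet X.carrier) : Ω →ₘ[μ] ℝ) ω| ∂μ
        ≤ ∫ ω, (|(f : Ω →ₘ[μ] ℝ) ω * (h : Ω →ₘ[μ] ℝ) ω|
            + |(f : Ω →ₘ[μ] ℝ) ω * (k : Ω →ₘ[μ] ℝ) ω|) ∂μ := by
          apply integral_mono_ae (mem_kotheSet.1 (h + k).2 f f.2).abs (h1.abs.add h2.abs)
          filter_upwards [AEEqFun.coeFn_add (h : Ω →ₘ[μ] ℝ) k] with ω h3
          have h4 : ((h + k : kotheSet X.carrier) : Ω →ₘ[μ] ℝ) ω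
            = (h : Ω →ₘ[μ] ℝ) ω + (k : Ω →ₘ[μ] ℝ) ω := h3
          rw [h4, mul_add]
          exact abs_add_le _ _
      _ = _ := integral_add h1.abs h2.abs
      _ ≤ _ := add_le_add (le_ciSup (X.bddAbove_kothe h.2) ⟨f, hf⟩)
          (le_ciSup (X.bddAbove_kothe k.2) ⟨f, hf⟩)
  neg' := fun h => by
    have := X.kotheNorm_smul (-1) (h : Ω →ₘ[μ] ℝ)
    simpa using this
  eq_zero_of_map_eq_zero' := fun h h0 => Subtype.ext (X.eq_zero_of_kotheNorm hX h.2 h0)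

/-- The Köthe dual `X'` of a saturated Banach function space, as a Banach function space. -/
def kotheDual {Ω : Type*} [MeasurableSpace Ω] {μ : Measure Ω} (X : BanachFunctionSpace μ)
    (hX : Saturated X.carrier) : BanachFunctionSpace μ where
  carrier := kotheSet X.carrier
  norm := X.kotheAddGroupNorm hX
  norm_smul c h := X.kotheNorm_smul c h
  solid h k hhk := ⟨(X.kotheNorm_solid k.2 hhk).1, (X.kotheNorm_solid k.2 hhk).2⟩
  complete := by
    let := (X.kotheAddGroupNorm hX).toNormedAddCommGroup
    refine NormedAddCommGroup.completeSpace_of_summable_imp_tendsto fun u hu => ?_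
    obtain ⟨h, hh⟩ := X.kothe_complete hX u hu
    exact ⟨h, tendsto_iff_norm_sub_tendsto_zero.2 hh⟩

end KotheDual

/-- The sums `∑ₙ ‖fₙ‖ ‖gₙ‖` of the representations `|h| ≤ ∑ₙ |fₙ gₙ|` a.e. with `fₙ ∈ X`,
`gₙ ∈ Y`. The product space `X π Y` consists of the `h` for which this set is non-empty. -/
def piSums {Ω : Type*} [MeasurableSpace Ω] {μ : Measure Ω} (X Y : BanachFunctionSpace μ)
    (h : Ω →ₘ[μ] ℝ) : Set ℝ :=
  {c | ∃ (f : ℕ → X) (g : ℕ → Y), HasSum (fun n => ‖f n‖ * ‖g n‖) c ∧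
    ∀ᵐ ω ∂μ, ‖h ω‖ₑ ≤ ∑' n, ‖(f n : Ω →ₘ[μ] ℝ) ω * (g n : Ω →ₘ[μ] ℝ) ω‖ₑ}

/-- The norm of the product space `X π Y`. -/
def piNorm {Ω : Type*} [MeasurableSpace Ω] {μ : Measure Ω} (X Y : BanachFunctionSpace μ)
    (h : Ω →ₘ[μ] ℝ) : ℝ :=
  sInf (piSums X Y h)

/-- The multiplication operator `M_h : X → Y`, `f ↦ f h`, for `h ∈ X^Y`. -/
def mulOp {Ω : Type*} [MeasurableSpace Ω] {μ : Measure Ω} {X Y : BanachFunctionSpace μ}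
    (h : multSpace X.carrier Y.carrier) (f : X) : Y :=
  ⟨(f : Ω →ₘ[μ] ℝ) * h, h.2 f f.2⟩

section Factorization

variable {Ω Δ : Type*} [MeasurableSpace Ω] [MeasurableSpace Δ] {μ : Measure Ω} {ν : Measure Δ}
  {X₁ X₂ : BanachFunctionSpace μ} {Y₁ Y₂ : BanachFunctionSpace ν}

/-- `T` factors strongly through `S` and `M_h`: there is `g ∈ Y₂^{Y₁''}` with `T f = g S(h f)` for
all `f ∈ X₁`. -/
def FactorsStrongly (T : X₁ →L[ℝ] Y₁) (S : X₂ →L[ℝ] Y₂) (h : multSpace X₁.carrier X₂.carrier) :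
    Prop :=
  ∃ g ∈ multSpace Y₂.carrier (Y₁.kotheBidual),
    ∀ f : X₁, (T f : Δ →ₘ[ν] ℝ) = g * (S (mulOp h f) : Δ →ₘ[ν] ℝ)

/-- There is `C > 0` such that `∑_{i<n} ∫ T(xᵢ) γᵢ dν ≤ C ‖∑_{i<n} S(h xᵢ) γᵢ‖` for all `n` and
all `xᵢ ∈ X₁`, with the norm of `Y₂ π Y₁'` on the right. -/
def BasisInequality (hY₁ : Saturated Y₁.carrier) (T : X₁ →L[ℝ] Y₁) (S : X₂ →L[ℝ] Y₂)
    (h : multSpace X₁.carrier X₂.carrier) (γ : ℕ → Y₁.kotheDual hY₁) : Prop :=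
  ∃ C : ℝ, 0 < C ∧ ∀ (n : ℕ) (x : ℕ → X₁),
    ∑ i ∈ Finset.range n, ∫ ω, (T (x i) : Δ →ₘ[ν] ℝ) ω * (γ i : Δ →ₘ[ν] ℝ) ω ∂ν ≤
      C * piNorm Y₂ (Y₁.kotheDual hY₁)
        (∑ i ∈ Finset.range n, (S (mulOp h (x i)) : Δ →ₘ[ν] ℝ) * (γ i : Δ →ₘ[ν] ℝ))

/-- There is `C > 0` such that `∫ T(x) γₙ dν ≤ C ∫ |S(h x) γₙ| dν` for all `n` and all `x ∈ X₁`. -/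
def SingleTermInequality (hY₁ : Saturated Y₁.carrier) (T : X₁ →L[ℝ] Y₁) (S : X₂ →L[ℝ] Y₂)
    (h : multSpace X₁.carrier X₂.carrier) (γ : ℕ → Y₁.kotheDual hY₁) : Prop :=
  ∃ C : ℝ, 0 < C ∧ ∀ (n : ℕ) (x : X₁),
    ∫ ω, (T x : Δ →ₘ[ν] ℝ) ω * (γ n : Δ →ₘ[ν] ℝ) ω ∂ν ≤
      C * ∫ ω, |(S (mulOp h x) : Δ →ₘ[ν] ℝ) ω * (γ n : Δ →ₘ[ν] ℝ) ω| ∂ν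

end Factorization

end BanachFunctionSpace

end

namespace BanachFunctionSpace

/-! ### Order and norm in a Banach function space -/

section Basic

variable {Ω : Type*} [MeasurableSpace Ω] {μ : Measure Ω}

/-! A function `g` maps `Y₂` into `Y₁''` by multiplication exactly when it multiplies every product
of an element of `Y₂` and an element of `Y₁'` into `L¹` (`mem_multSpace_kotheBidual`). Such a `g` is
therefore an integral functional on the span of these products. Strong factorization says that this
functional sends `S(hx) γᵢ` to `∫ T(x) γᵢ` for all `x` and `i`. Testing on the `γᵢ` suffices,
because they form a basis of `Y₁'` and integrals against `Y₁'` separate the elements of `Y₁''`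
(`eq_zero_of_integral_basis_eq_zero`).

Factorization implies the inequality because integration against `g` is automatically bounded for
the product norm: unboundedness would produce, by summing scaled bad elements, one product not sent
into `L¹` (`exists_bilinear_bound`, `exists_integral_le_piNorm`).

For the converse, the inequality says that `∑ S(hxᵢ) γᵢ ↦ ∑ ∫ T(xᵢ) γᵢ` is well defined and bounded
by the product norm, so Hahn–Banach extends it to a functional `Φ` on all functions dominated by
products (`exists_density_of_comp_le_piNorm`). Order continuity of one factor gives a dominated
convergence theorem for `Φ`. Hence `A ↦ Φ(1_A w)` is a signed measure, absolutely continuous with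
respect to `ν`, and its Radon–Nikodym density divided by `w` represents `Φ`
(`ProdFunctional.exists_density`). Here `w` is a product of weak units of `Y₂` and `Y₁'`. The second
one exists because `Y₁'` is saturated (`saturated_kotheSet`), which is a separation argument in
`L²`.

For disjoint supports, `∑ ∫ |S(hxᵢ) γᵢ|` equals `∫ |∑ S(hxᵢ) γᵢ|`, and the constant multiplier `1`
bounds this by the product norm. If all multipliers are bounded functions, a factorization gives the
single-term inequality at once. -/

theorem exists_of_abs_le (X : BanachFunctionSpace μ) {F : Ω → ℝ} (hF : AEStronglyMeasurable F μ)
    (g : X) (h : ∀ᵐ ω ∂μ, |F ω| ≤ |(g : Ω →ₘ[μ] ℝ) ω|) :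
    ∃ u : X, (u : Ω →ₘ[μ] ℝ) =ᵐ[μ] F ∧ ‖u‖ ≤ ‖g‖ := by
  have hm := AEEqFun.coeFn_mk F hF
  obtain ⟨h1, h2⟩ := X.solid (AEEqFun.mk F hF) g (by filter_upwards [hm, h] with ω a b; rwa [a])
  exact ⟨⟨_, h1⟩, hm, h2⟩

theorem norm_le_of_abs_le (X : BanachFunctionSpace μ) (f g : X)
    (h : ∀ᵐ ω ∂μ, |(f : Ω →ₘ[μ] ℝ) ω| ≤ |(g : Ω →ₘ[μ] ℝ) ω|) : ‖f‖ ≤ ‖g‖ :=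
  (X.solid f g h).2

theorem exists_abs (X : BanachFunctionSpace μ) (f : X) :
    ∃ u : X, (u : Ω →ₘ[μ] ℝ) =ᵐ[μ] (fun ω => |(f : Ω →ₘ[μ] ℝ) ω|) ∧ ‖u‖ ≤ ‖f‖ :=
  X.exists_of_abs_le (AEEqFun.measurable _).abs.aestronglyMeasurable f
    (Eventually.of_forall fun _ => (abs_abs _).le)

theorem coeFn_add' (X : BanachFunctionSpace μ) (f g : X) :
    ((f + g : X) : Ω →ₘ[μ] ℝ) =ᵐ[μ]
      fun ω => (f : Ω →ₘ[μ] ℝ) ω + (g : Ω →ₘ[μ] ℝ) ω := AEEqFun.coeFn_add _ _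

theorem coeFn_smul' (X : BanachFunctionSpace μ) (c : ℝ) (f : X) :
    ((c • f : X) : Ω →ₘ[μ] ℝ) =ᵐ[μ] fun ω => c * (f : Ω →ₘ[μ] ℝ) ω := AEEqFun.coeFn_smul _ _

theorem coeFn_zero' (X : BanachFunctionSpace μ) :
    ((0 : X) : Ω →ₘ[μ] ℝ) =ᵐ[μ] fun _ => (0 : ℝ) := AEEqFun.coeFn_zero

/-- The series `∑ |vₙ|` converges in norm by completeness, and norm limits preserve a.e.
inequalities, so its sum lies above every term. This is the device behind all the boundedness
arguments below. -/
theorem exists_dominating (X : BanachFunctionSpace μ) (v : ℕ → X) (hv : Summable fun n => ‖v n‖) :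
    ∃ V : X, ∀ n, ∀ᵐ ω ∂μ, |(v n : Ω →ₘ[μ] ℝ) ω| ≤ (V : Ω →ₘ[μ] ℝ) ω := by
  choose u hu hun using fun n => X.exists_abs (v n)
  have hsum : Summable u := Summable.of_norm_bounded hv hun
  have hpart : ∀ N, ∀ᵐ ω ∂μ, ((∑ i ∈ Finset.range N, u i : X) : Ω →ₘ[μ] ℝ) ω
      = ∑ i ∈ Finset.range N, (u i : Ω →ₘ[μ] ℝ) ω := by
    intro N
    induction N with
    | zero =>
      filter_upwards [X.coeFn_zero'] with ω h4
      simpa using h4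
    | succ N ih =>
      filter_upwards [ih, X.coeFn_add' (∑ i ∈ Finset.range N, u i) (u N)] with ω h1 h2
      rw [Finset.sum_range_succ, Finset.sum_range_succ, ← h1]
      exact h2
  refine ⟨∑' n, u n, fun n => ?_⟩
  have h1 : ∀ᵐ ω ∂μ, (u n : Ω →ₘ[μ] ℝ) ω ≤ ((∑' n, u n : X) : Ω →ₘ[μ] ℝ) ω := by
    apply X.ae_le_of_tendsto (u n) _ _ hsum.hasSum.tendsto_sum_nat
    filter_upwards [eventually_gt_atTop n] with N hN
    filter_upwards [hpart N, ae_all_iff.2 hu] with ω h1 h2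
    rw [h1]
    exact Finset.single_le_sum (f := fun i => (u i : Ω →ₘ[μ] ℝ) ω)
      (fun i _ => by rw [h2]; exact abs_nonneg _) (Finset.mem_range.2 hN)
  filter_upwards [h1, hu n] with ω h2 h3
  rwa [← h3]

/-- Order continuity speaks only of decreasing sequences. The tail suprema `sup_m |f (n + m)|`
decrease to `0`, stay below `|g|`, and dominate `|f n|`. -/
theorem tendsto_norm_zero_of_dominated (X : BanachFunctionSpace μ) (hX : X.SigmaOrderContinuous)
    (f : ℕ → X) (g : X)
    (hle : ∀ n, ∀ᵐ ω ∂μ, |(f n : Ω →ₘ[μ] ℝ) ω| ≤ |(g : Ω →ₘ[μ] ℝ) ω|)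
    (hlim : ∀ᵐ ω ∂μ, Tendsto (fun n => (f n : Ω →ₘ[μ] ℝ) ω) atTop (𝓝 0)) :
    Tendsto (fun n => ‖f n‖) atTop (𝓝 0) := by
  let G : ℕ → Ω → ℝ := fun n ω => ⨆ m, |(f (n + m) : Ω →ₘ[μ] ℝ) ω|
  have hGm : ∀ n, Measurable (G n) := fun n =>
    Measurable.iSup fun m => (AEEqFun.measurable _).abs
  have hle' := ae_all_iff.2 hle
  have hbdd : ∀ᵐ ω ∂μ, ∀ n, BddAbove (Set.range fun m => |(f (n + m) : Ω →ₘ[μ] ℝ) ω|) := by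
    filter_upwards [hle'] with ω h n
    exact ⟨_, by rintro _ ⟨m, rfl⟩; exact h _⟩
  have hG0 : ∀ n ω, 0 ≤ G n ω := fun n ω => Real.iSup_nonneg fun _ => abs_nonneg _
  have hGle : ∀ n, ∀ᵐ ω ∂μ, |G n ω| ≤ |(g : Ω →ₘ[μ] ℝ) ω| := by
    intro n
    filter_upwards [hle'] with ω h
    rw [abs_of_nonneg (hG0 n ω)]
    exact ciSup_le fun m => h _
  choose u hu hun using fun n => X.exists_of_abs_le (hGm n).aestronglyMeasurable g (hGle n)
  have hlu : ∀ n, ‖f n‖ ≤ ‖u n‖ := by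
    intro n
    apply X.norm_le_of_abs_le
    filter_upwards [hu n, hbdd] with ω h1 h2
    rw [h1, abs_of_nonneg (hG0 n ω)]
    exact le_ciSup (h2 n) 0
  refine squeeze_zero (fun n => norm_nonneg _) hlu (hX u ?_)
  filter_upwards [ae_all_iff.2 hu, hbdd, hlim] with ω h1 h2 h3
  simp only [h1]
  constructor
  · intro a b hab
    refine ciSup_le fun m => ?_
    have := le_ciSup (h2 a) (b - a + m)
    rwa [show a + (b - a + m) = b + m by omega] at this
  · rw [Metric.tendsto_atTop] at h3 ⊢
    intro ε hε
    obtain ⟨N, hN⟩ := h3 (ε / 2) (half_pos hε)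
    refine ⟨N, fun n hn => ?_⟩
    rw [Real.dist_eq, sub_zero, abs_of_nonneg (hG0 n ω)]
    refine lt_of_le_of_lt (ciSup_le fun m => ?_) (half_lt_self hε)
    have := (hN (n + m) (by omega)).le
    rwa [Real.dist_eq, sub_zero] at this

theorem exists_dominating_scaled (X : BanachFunctionSpace μ) (f : ℕ → X) :
    ∃ V : X, ∀ n, ∃ c : ℝ, 0 < c ∧ ∀ᵐ ω ∂μ,
      c * |(f n : Ω →ₘ[μ] ℝ) ω| ≤ (V : Ω →ₘ[μ] ℝ) ω := by
  -- The weights make the norms summable; the `+ 1` keeps them positive and finite when `f n = 0`.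
  have hc : ∀ n, 0 < (2 : ℝ)⁻¹ ^ n * (‖f n‖ + 1)⁻¹ := fun n => by positivity
  obtain ⟨V, hV⟩ := X.exists_dominating (fun n => ((2 : ℝ)⁻¹ ^ n * (‖f n‖ + 1)⁻¹) • f n) (by
    refine Summable.of_nonneg_of_le (fun n => norm_nonneg _) (fun n => ?_)
      (summable_geometric_of_lt_one (r := (2 : ℝ)⁻¹) (by norm_num) (by norm_num))
    rw [_root_.norm_smul, Real.norm_of_nonneg (hc n).le, mul_assoc]
    refine mul_le_of_le_one_right (by positivity) ?_
    rw [inv_mul_le_iff₀ (by positivity)]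
    linarith)
  refine ⟨V, fun n => ⟨_, hc n, ?_⟩⟩
  filter_upwards [hV n, X.coeFn_smul' ((2 : ℝ)⁻¹ ^ n * (‖f n‖ + 1)⁻¹) (f n)] with ω h1 h2
  rwa [h2, abs_mul, abs_of_pos (hc n)] at h1

/-- A saturated Banach function space over a `σ`-finite measure has a weak unit. -/
theorem exists_ae_pos [SigmaFinite μ] (X : BanachFunctionSpace μ) (hX : Saturated X.carrier) :
    ∃ f : X, ∀ᵐ ω ∂μ, 0 < (f : Ω →ₘ[μ] ℝ) ω := by
  -- A finite measure with the same null sets: the measures of the supports then have a finite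
  -- supremum, and an element dominating scaled copies of a maximizing sequence attains it.
  let m := μ.toFinite
  let P : X → ℝ≥0∞ := fun f => m {ω | (f : Ω →ₘ[μ] ℝ) ω ≠ 0}
  obtain ⟨p, -, hp, hpm⟩ := exists_seq_tendsto_sSup (Set.range_nonempty P) (OrderTop.bddAbove _)
  choose f hf using hpm
  obtain ⟨V, hV⟩ := X.exists_dominating_scaled f
  have hV0 : ∀ᵐ ω ∂μ, 0 ≤ (V : Ω →ₘ[μ] ℝ) ω := by
    obtain ⟨c, hc, h⟩ := hV 0
    filter_upwards [h] with ω h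
    exact (by positivity : 0 ≤ c * |(f 0 : Ω →ₘ[μ] ℝ) ω|).trans h
  have hPV : ∀ g : X, P g ≤ P V := by
    intro g
    refine (le_sSup (Set.mem_range_self g)).trans (le_of_tendsto' hp fun n => ?_)
    rw [← hf n]
    apply measure_mono_ae
    obtain ⟨c, hc, h⟩ := hV n
    filter_upwards [toFinite_absolutelyContinuous μ h] with ω h h1
    have h2 : 0 < |(f n : Ω →ₘ[μ] ℝ) ω| := abs_pos.2 h1
    exact (lt_of_lt_of_le (by positivity) h).ne'
  refine ⟨V, ?_⟩
  by_contra hne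
  apply hX
  refine ⟨{ω | (V : Ω →ₘ[μ] ℝ) ω = 0}, (AEEqFun.measurable _) (measurableSet_singleton 0), ?_, ?_⟩
  · rw [pos_iff_ne_zero]
    intro h0
    apply hne
    filter_upwards [measure_eq_zero_iff_ae_notMem.1 h0, hV0] with ω h1 h2
    exact lt_of_le_of_ne h2 (Ne.symm h1)
  · intro g hg
    obtain ⟨u, hu, -⟩ := X.exists_abs ⟨g, hg⟩
    -- If `g` did not vanish a.e. on `{V = 0}`, then `V + |g|` would have a strictly larger support
    -- than the maximal one.
    have h1 := hPV (V + u)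
    have hB : MeasurableSet ({ω | (V : Ω →ₘ[μ] ℝ) ω = 0} ∩ {ω | g ω ≠ 0}) :=
      ((AEEqFun.measurable _) (measurableSet_singleton 0)).inter
        ((AEEqFun.measurable _) (measurableSet_singleton 0).compl)
    have h2 : P V + m ({ω | (V : Ω →ₘ[μ] ℝ) ω = 0} ∩ {ω | g ω ≠ 0}) ≤ P (V + u) := by
      rw [← measure_union _ hB]
      · apply measure_mono_ae
        have := toFinite_absolutelyContinuous μ ((X.coeFn_add' V u).and (hu.and hV0))
        filter_upwards [this] with ω h3 h4
        obtain ⟨h5, h6, h7⟩ := h3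
        change ((V + u : X) : Ω →ₘ[μ] ℝ) ω ≠ 0
        rw [h5, h6]
        rcases h4 with h4 | h4
        · have : 0 < (V : Ω →ₘ[μ] ℝ) ω := lt_of_le_of_ne h7 (Ne.symm h4)
          positivity
        · have h8 : 0 < |g ω| := abs_pos.2 h4.2
          exact (add_pos_of_nonneg_of_pos h7 h8).ne'
      · rw [Set.disjoint_left]
        rintro ω h3 ⟨h4, -⟩
        exact h3 h4
    have h3 : m ({ω | (V : Ω →ₘ[μ] ℝ) ω = 0} ∩ {ω | g ω ≠ 0}) = 0 := by
      have h4 : P V + m ({ω | (V : Ω →ₘ[μ] ℝ) ω = 0} ∩ {ω | g ω ≠ 0}) ≤ P V + 0 := by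
        rw [add_zero]; exact h2.trans h1
      exact le_zero_iff.1 ((ENNReal.add_le_add_iff_left (measure_ne_top m _)).1 h4)
    filter_upwards [measure_eq_zero_iff_ae_notMem.1 (absolutelyContinuous_toFinite μ h3)]
      with ω h4 h5
    by_contra h6
    exact h4 ⟨h5, h6⟩

/-- The unit ball of a Banach function space is bounded in measure on sets of finite measure. -/
theorem exists_measure_le (X : BanachFunctionSpace μ) {A : Set Ω} (hA : MeasurableSet A)
    (hA' : μ A ≠ ∞) {ε : ℝ≥0∞} (hε : 0 < ε) :
    ∃ M : ℝ, 0 < M ∧ ∀ f : X, ‖f‖ ≤ 1 → μ (A ∩ {ω | M < |(f : Ω →ₘ[μ] ℝ) ω|}) ≤ ε := by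
  by_contra! hcon
  -- Heights `4 ^ n` against weights `2⁻ⁿ`: the dominating `V` exceeds `2 ^ n` on a subset of `A` of
  -- measure at least `ε` for every `n`, although these sets decrease to the empty set.
  choose f hf hfε using fun n : ℕ => hcon (4 ^ n) (by positivity)
  obtain ⟨V, hV⟩ := X.exists_dominating (fun n => (2 : ℝ)⁻¹ ^ n • f n) (by
    refine Summable.of_nonneg_of_le (fun n => norm_nonneg _) (fun n => ?_)
      (summable_geometric_of_lt_one (r := (2 : ℝ)⁻¹) (by norm_num) (by norm_num))
    rw [_root_.norm_smul, Real.norm_of_nonneg (by positivity)]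
    exact mul_le_of_le_one_right (by positivity) (hf n))
  let B : ℕ → Set Ω := fun n => A ∩ {ω | (2 : ℝ) ^ n < (V : Ω →ₘ[μ] ℝ) ω}
  have hB : ∀ n, ε ≤ μ (B n) := by
    intro n
    refine (hfε n).le.trans (measure_mono_ae ?_)
    filter_upwards [hV n, X.coeFn_smul' ((2 : ℝ)⁻¹ ^ n) (f n)] with ω h1 h2 h3
    refine ⟨h3.1, ?_⟩
    have h4 : (4 : ℝ) ^ n < |(f n : Ω →ₘ[μ] ℝ) ω| := h3.2
    rw [h2, abs_mul, abs_of_nonneg (by positivity)] at h1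
    refine lt_of_lt_of_le ?_ h1
    calc (2 : ℝ) ^ n = (2 : ℝ)⁻¹ ^ n * 4 ^ n := by rw [← mul_pow]; norm_num
      _ < _ := by gcongr
  have hlim := tendsto_measure_iInter_atTop (μ := μ) (s := B)
    (fun n => (hA.inter (measurableSet_lt measurable_const
      (AEEqFun.measurable _))).nullMeasurableSet)
    (fun a b hab ω h => ⟨h.1, lt_of_le_of_lt
      (pow_le_pow_right₀ (by norm_num) hab : (2 : ℝ) ^ a ≤ 2 ^ b) h.2⟩)
    ⟨0, ne_top_of_le_ne_top hA' (measure_mono Set.inter_subset_left)⟩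
  have hempty : ⋂ n, B n = ∅ := by
    ext ω
    simp only [Set.mem_iInter, Set.mem_empty_iff_false, iff_false]
    intro h
    obtain ⟨n, hn⟩ := pow_unbounded_of_one_lt ((V : Ω →ₘ[μ] ℝ) ω) (one_lt_two : (1 : ℝ) < 2)
    exact lt_asymm hn (h n).2
  rw [hempty, measure_empty] at hlim
  exact absurd (ge_of_tendsto' hlim hB) (not_le.2 hε)

/-- Fatou's lemma. It yields integrability from a uniform `L¹` bound when no integrable majorant is
known yet. -/
theorem integrable_of_tendsto_of_integral_le {F : ℕ → Ω → ℝ} {f : Ω → ℝ} {c : ℝ}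
    (hF : ∀ n, Integrable (F n) μ) (hc : ∀ n, ∫ ω, |F n ω| ∂μ ≤ c)
    (hlim : ∀ᵐ ω ∂μ, Tendsto (fun n => F n ω) atTop (𝓝 (f ω))) : Integrable f μ := by
  refine ⟨aestronglyMeasurable_of_tendsto_ae atTop (fun n => (hF n).1) hlim, ?_⟩
  have h1 : ∫⁻ ω, ‖f ω‖ₑ ∂μ ≤ liminf (fun n => ∫⁻ ω, ‖F n ω‖ₑ ∂μ) atTop := by
    rw [lintegral_congr_ae (g := fun ω => liminf (fun n => ‖F n ω‖ₑ) atTop)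
      (by filter_upwards [hlim] with x hx using hx.enorm.liminf_eq.symm)]
    exact lintegral_liminf_le' fun n => (hF n).1.enorm
  refine lt_of_le_of_lt (h1.trans ?_) (ENNReal.ofReal_lt_top (r := c))
  refine (liminf_le_liminf (Eventually.of_forall fun n => ?_)).trans
    (liminf_const (ENNReal.ofReal c)).le
  have h2 := ofReal_integral_norm_eq_lintegral_enorm (hF n)
  rw [← h2]
  exact ENNReal.ofReal_le_ofReal (hc n)

end Basic

/-! ### Saturation of the Köthe dual, by separation in `L²` -/

section KotheSaturated

variable {Ω : Type*} [MeasurableSpace Ω] {μ : Measure Ω}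

/-- The square integrable functions on `A` that are dominated by an element of the unit ball. -/
def ballL2 (X : BanachFunctionSpace μ) (A : Set Ω) : Set (Lp ℝ 2 (μ.restrict A)) :=
  {u | ∃ f : X, ‖f‖ ≤ 1 ∧ ∀ᵐ ω ∂μ.restrict A, |u ω| ≤ |(f : Ω →ₘ[μ] ℝ) ω|}

theorem convex_ballL2 (X : BanachFunctionSpace μ) (A : Set Ω) : Convex ℝ (X.ballL2 A) := by
  rintro u ⟨f, hf, huf⟩ v ⟨g, hg, hvg⟩ a b ha hb hab
  obtain ⟨f', hf', hf'n⟩ := X.exists_abs f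
  obtain ⟨g', hg', hg'n⟩ := X.exists_abs g
  refine ⟨a • f' + b • g', ?_, ?_⟩
  · refine (norm_add_le _ _).trans ?_
    rw [_root_.norm_smul, _root_.norm_smul, Real.norm_of_nonneg ha, Real.norm_of_nonneg hb, ← hab]
    exact add_le_add (mul_le_of_le_one_right ha (hf'n.trans hf))
      (mul_le_of_le_one_right hb (hg'n.trans hg))
  · filter_upwards [huf, hvg, ae_restrict_of_ae hf', ae_restrict_of_ae hg',
      ae_restrict_of_ae (X.coeFn_add' (a • f') (b • g')), ae_restrict_of_ae (X.coeFn_smul' a f'),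
      ae_restrict_of_ae (X.coeFn_smul' b g'), Lp.coeFn_add (a • u) (b • v),
      Lp.coeFn_smul a u, Lp.coeFn_smul b v] with ω h1 h2 h3 h4 h5 h6 h7 h8 h9 h10
    rw [h8, Pi.add_apply, h9, h10, h5, h6, h7, h3, h4, Pi.smul_apply, Pi.smul_apply, smul_eq_mul,
      smul_eq_mul, abs_of_nonneg (by positivity : 0 ≤ a * |(f : Ω →ₘ[μ] ℝ) ω|
        + b * |(g : Ω →ₘ[μ] ℝ) ω|)]
    refine (abs_add_le _ _).trans ?_
    rw [abs_mul, abs_mul, abs_of_nonneg ha, abs_of_nonneg hb]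
    gcongr

/-- The unit ball is bounded in measure: each of its elements is at most some fixed `M` off a subset
of `A` of measure `μ A / 2`. The constant `2 * M` then differs from it by at least `M` on half of
`A`, which excludes convergence in measure and so in `L²`. -/
theorem exists_notMem_closure_ballL2 (X : BanachFunctionSpace μ) {A : Set Ω} (hA : MeasurableSet A)
    (hA0 : 0 < μ A) (hA' : μ A < ∞) [IsFiniteMeasure (μ.restrict A)] :
    ∃ c : ℝ, 0 < c ∧
      (memLp_const c : MemLp (fun _ : Ω => c) 2 (μ.restrict A)).toLp ∉ closure (X.ballL2 A) := by
  obtain ⟨M, hM, hMf⟩ := X.exists_measure_le hA hA'.ne (ENNReal.half_pos hA0.ne')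
  refine ⟨2 * M, by positivity, fun hmem => ?_⟩
  have hC := MemLp.coeFn_toLp (memLp_const (2 * M) :
    MemLp (fun _ : Ω => 2 * M) 2 (μ.restrict A))
  set C : Lp ℝ 2 (μ.restrict A) := (memLp_const (2 * M) :
    MemLp (fun _ : Ω => 2 * M) 2 (μ.restrict A)).toLp
  obtain ⟨u, hu, hlim⟩ := mem_closure_iff_seq_limit.1 hmem
  have h1 := tendstoInMeasure_of_tendsto_Lp hlim (ENNReal.ofReal M) (ENNReal.ofReal_pos.2 hM)
  have h2 : ∀ n, μ A / 2 ≤ μ.restrict A {ω | ENNReal.ofReal M ≤ edist (u n ω) (C ω)} := by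
    intro n
    obtain ⟨f, hf, hfu⟩ := hu n
    have h3 : μ.restrict A {ω | |(f : Ω →ₘ[μ] ℝ) ω| ≤ M} ≤ μ.restrict A
        {ω | ENNReal.ofReal M ≤ edist (u n ω) (C ω)} := by
      apply measure_mono_ae
      filter_upwards [hfu, hC] with ω h4 h5 h6
      have h6' : |(f : Ω →ₘ[μ] ℝ) ω| ≤ M := h6
      change ENNReal.ofReal M ≤ edist _ _
      rw [h5, edist_dist, Real.dist_eq]
      apply ENNReal.ofReal_le_ofReal
      have := abs_le.1 (h4.trans h6')
      rw [abs_of_nonpos (by linarith)]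
      linarith
    refine le_trans ?_ h3
    have hms : MeasurableSet {ω | |(f : Ω →ₘ[μ] ℝ) ω| ≤ M} :=
      measurableSet_le (AEEqFun.measurable _).abs measurable_const
    rw [Measure.restrict_apply hms]
    have h7 : μ A ≤ μ ({ω | |(f : Ω →ₘ[μ] ℝ) ω| ≤ M} ∩ A)
        + μ (A ∩ {ω | M < |(f : Ω →ₘ[μ] ℝ) ω|}) := by
      refine le_trans (measure_mono fun ω hω => ?_) (measure_union_le _ _)
      rcases le_or_gt |(f : Ω →ₘ[μ] ℝ) ω| M with h | h
      · exact Or.inl ⟨h, hω⟩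
      · exact Or.inr ⟨hω, h⟩
    have h8 : μ A / 2 + μ A / 2 ≤ μ ({ω | |(f : Ω →ₘ[μ] ℝ) ω| ≤ M} ∩ A) + μ A / 2 := by
      rw [ENNReal.add_halves]
      exact h7.trans (add_le_add le_rfl (hMf f hf))
    exact (ENNReal.add_le_add_iff_right (ENNReal.div_lt_top hA'.ne two_ne_zero).ne).1 h8
  exact absurd (ge_of_tendsto' h1 h2) (not_le.2 (ENNReal.half_pos hA0.ne'))

theorem integrable_mul_indicator_of_ballL2_bound (X : BanachFunctionSpace μ) {A : Set Ω}
    (hA : MeasurableSet A) [IsFiniteMeasure (μ.restrict A)] (w : Lp ℝ 2 (μ.restrict A)) {c : ℝ}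
    (hw : ∀ u ∈ X.ballL2 A, ∫ ω, u ω * w ω ∂μ.restrict A ≤ c) (f : X) :
    Integrable (fun ω => (f : Ω →ₘ[μ] ℝ) ω * A.indicator (fun ω => max (w ω) 0) ω) μ := by
  have hwm : Measurable w := (Lp.stronglyMeasurable w).measurable
  have key : ∀ f : X, ‖f‖ ≤ 1 →
      Integrable (fun ω => |(f : Ω →ₘ[μ] ℝ) ω| * max (w ω) 0) (μ.restrict A) := by
    intro f hf
    -- Truncation makes the test function square integrable, and restriction to `{w > 0}` turns the
    -- pairing with `w` into one with its positive part. Fatou's lemma removes the truncation.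
    let v : ℕ → Ω → ℝ := fun n ω => if 0 < w ω then min |(f : Ω →ₘ[μ] ℝ) ω| n else 0
    have hv0 : ∀ n ω, 0 ≤ v n ω := by
      intro n ω
      simp only [v]; split_ifs <;> positivity
    have hvn : ∀ n ω, v n ω ≤ n := by
      intro n ω
      simp only [v]; split_ifs
      · exact min_le_right _ _
      · positivity
    have hvf : ∀ n ω, v n ω ≤ |(f : Ω →ₘ[μ] ℝ) ω| := by
      intro n ω
      simp only [v]; split_ifs
      · exact min_le_left _ _
      · positivity
    have hvw : ∀ n ω, v n ω * max (w ω) 0 = v n ω * w ω := by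
      intro n ω
      simp only [v]; split_ifs with h
      · rw [max_eq_left h.le]
      · simp
    have hvm : ∀ n, Measurable (v n) := fun n =>
      Measurable.ite (measurableSet_lt measurable_const hwm)
        ((AEEqFun.measurable _).abs.min measurable_const) measurable_const
    have hvL : ∀ n, MemLp (v n) 2 (μ.restrict A) := fun n =>
      MemLp.of_bound (hvm n).aestronglyMeasurable n (Eventually.of_forall fun ω => by
        rw [Real.norm_of_nonneg (hv0 n ω)]; exact hvn n ω)
    have hint : ∀ n, Integrable (fun ω => v n ω * max (w ω) 0) (μ.restrict A) := by
      intro n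
      simp only [hvw]
      exact (hvL n).integrable_mul (Lp.memLp w)
    refine integrable_of_tendsto_of_integral_le hint (c := c) (fun n => ?_) ?_
    · refine le_trans (le_of_eq ?_) (hw ((hvL n).toLp) ⟨f, hf, ?_⟩)
      · apply integral_congr_ae
        filter_upwards [(hvL n).coeFn_toLp] with ω h1
        rw [h1, ← hvw, abs_of_nonneg (mul_nonneg (hv0 n ω) (le_max_right _ _))]
      · filter_upwards [(hvL n).coeFn_toLp] with ω h1
        rw [h1, abs_of_nonneg (hv0 n ω)]
        exact hvf n ω
    · refine Eventually.of_forall fun ω => ?_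
      obtain ⟨N, hN⟩ := exists_nat_ge |(f : Ω →ₘ[μ] ℝ) ω|
      refine tendsto_const_nhds.congr' ?_
      filter_upwards [eventually_ge_atTop N] with n hn
      have : |(f : Ω →ₘ[μ] ℝ) ω| ≤ n := hN.trans (by exact_mod_cast hn)
      simp only [v]
      split_ifs with h
      · rw [min_eq_left this]
      · rw [max_eq_right (not_lt.1 h)]; simp
  have hpos : 0 < ‖f‖ + 1 := by positivity
  have h1 := key ((‖f‖ + 1)⁻¹ • f) (by
    rw [_root_.norm_smul, Real.norm_of_nonneg (by positivity), inv_mul_le_iff₀ hpos]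
    linarith)
  have h2 : Integrable (fun ω => |(f : Ω →ₘ[μ] ℝ) ω| * max (w ω) 0) (μ.restrict A) := by
    refine (h1.const_mul (‖f‖ + 1)).congr ?_
    filter_upwards [ae_restrict_of_ae (X.coeFn_smul' (‖f‖ + 1)⁻¹ f)] with ω h3
    rw [h3, abs_mul, abs_of_pos (inv_pos.2 hpos), mul_assoc, ← mul_assoc,
      mul_inv_cancel₀ hpos.ne', one_mul]
  have h3 := (integrable_indicator_iff hA).2 h2
  refine h3.mono ((AEEqFun.measurable _).mul
    ((hwm.max measurable_const).indicator hA)).aestronglyMeasurable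
    (Eventually.of_forall fun ω => ?_)
  by_cases hω : ω ∈ A <;> simp [hω]

/-- The Köthe dual of a Banach function space over a `σ`-finite measure is saturated. -/
theorem saturated_kotheSet [SigmaFinite μ] (X : BanachFunctionSpace μ) :
    Saturated (kotheSet X.carrier) := by
  rintro ⟨s, hs, hs0, hvan⟩
  obtain ⟨A, hA, hAs, hA0, hA'⟩ := Measure.exists_subset_measure_lt_top hs hs0
  have : IsFiniteMeasure (μ.restrict A) := ⟨by rwa [Measure.restrict_apply_univ]⟩
  obtain ⟨c, hc, hmem⟩ := X.exists_notMem_closure_ballL2 hA hA0 hA'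
  -- Separate the constant from the closed convex set and represent the functional by `w ∈ L²`. The
  -- positive part of `w`, extended by `0` off `A`, lies in the Köthe dual.
  obtain ⟨ℓ, r, hℓ, hr⟩ := geometric_hahn_banach_closed_point (X.convex_ballL2 A).closure
    isClosed_closure hmem
  let w := (InnerProductSpace.toDual ℝ (Lp ℝ 2 (μ.restrict A))).symm ℓ
  have hℓw : ∀ u, ℓ u = ∫ ω, u ω * w ω ∂μ.restrict A := by
    intro u
    have h1 : inner ℝ w u = ℓ u := InnerProductSpace.toDual_symm_apply
    rw [← h1, L2.inner_def]
    rfl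
  have hint := X.integrable_mul_indicator_of_ballL2_bound hA w (c := r)
    fun u hu => by rw [← hℓw]; exact (hℓ u (subset_closure hu)).le
  have hr0 : 0 < r := by
    have := hℓ 0 (subset_closure ⟨0, by simp, by
      filter_upwards [Lp.coeFn_zero ℝ 2 (μ.restrict A)] with ω h1
      rw [h1]; simp⟩)
    rwa [map_zero] at this
  have hWm : Measurable (A.indicator fun ω => max (w ω) 0) :=
    (((Lp.stronglyMeasurable w).measurable).max measurable_const).indicator hA
  have hmk := AEEqFun.coeFn_mk _ (hWm.aestronglyMeasurable (μ := μ))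
  have h1 := hvan (AEEqFun.mk _ hWm.aestronglyMeasurable) (by
    rw [mem_kotheSet]
    intro f hf
    refine (hint ⟨f, hf⟩).congr ?_
    filter_upwards [hmk] with ω h2
    rw [h2])
  rw [hℓw] at hr
  -- Since `0` is in the ball, `0 < r < ∫ c w`; but if the positive part of `w` vanishes on `A`,
  -- this integral is at most `0`.
  refine absurd (hr0.trans hr) (not_lt.2 (integral_nonpos_of_ae ?_))
  filter_upwards [ae_restrict_of_ae h1, ae_restrict_of_ae hmk, ae_restrict_mem hA,
    MemLp.coeFn_toLp (memLp_const c : MemLp (fun _ : Ω => c) 2 (μ.restrict A))] with ω h2 h3 h4 h5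
  have h6 := h2 (hAs h4)
  rw [h3, Set.indicator_of_mem h4] at h6
  rw [h5]
  exact mul_nonpos_of_nonneg_of_nonpos hc.le (max_eq_right_iff.1 h6)

end KotheSaturated

/-! ### Functions dominated by products -/

section Product

variable {Ω : Type*} [MeasurableSpace Ω] {μ : Measure Ω}

/-- `F` is measurable and dominated by a product of an element of `X` and an element of `Y`. -/
def ProdDominated (X Y : BanachFunctionSpace μ) (F : Ω → ℝ) : Prop :=
  AEStronglyMeasurable F μ ∧ ∃ (f : X) (k : Y),
    ∀ᵐ ω ∂μ, |F ω| ≤ |(f : Ω →ₘ[μ] ℝ) ω * (k : Ω →ₘ[μ] ℝ) ω|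

theorem ProdDominated.mono {X Y : BanachFunctionSpace μ} {F G : Ω → ℝ} (hG : ProdDominated X Y G)
    (hF : AEStronglyMeasurable F μ) (h : ∀ᵐ ω ∂μ, |F ω| ≤ |G ω|) : ProdDominated X Y F := by
  obtain ⟨-, f, k, hfk⟩ := hG
  refine ⟨hF, f, k, ?_⟩
  filter_upwards [h, hfk] with ω h1 h2
  exact h1.trans h2

/-- A single product suffices: `|f₁ k₁| + |f₂ k₂| ≤ (|f₁| + |f₂|) (|k₁| + |k₂|)`. -/
theorem ProdDominated.add {X Y : BanachFunctionSpace μ} {F G : Ω → ℝ} (hF : ProdDominated X Y F)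
    (hG : ProdDominated X Y G) : ProdDominated X Y (fun ω => F ω + G ω) := by
  obtain ⟨hFm, f₁, k₁, h₁⟩ := hF
  obtain ⟨hGm, f₂, k₂, h₂⟩ := hG
  refine ⟨hFm.add hGm, ?_⟩
  obtain ⟨f₁', hf₁, -⟩ := X.exists_abs f₁
  obtain ⟨f₂', hf₂, -⟩ := X.exists_abs f₂
  obtain ⟨k₁', hk₁, -⟩ := Y.exists_abs k₁
  obtain ⟨k₂', hk₂, -⟩ := Y.exists_abs k₂
  refine ⟨f₁' + f₂', k₁' + k₂', ?_⟩
  filter_upwards [h₁, h₂, hf₁, hf₂, hk₁, hk₂, X.coeFn_add' f₁' f₂', Y.coeFn_add' k₁' k₂']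
    with ω a1 a2 a3 a4 a5 a6 a7 a8
  rw [a7, a8, a3, a4, a5, a6]
  rw [abs_mul] at a1 a2
  have b1 := abs_nonneg ((f₁ : Ω →ₘ[μ] ℝ) ω)
  have b2 := abs_nonneg ((f₂ : Ω →ₘ[μ] ℝ) ω)
  have b3 := abs_nonneg ((k₁ : Ω →ₘ[μ] ℝ) ω)
  have b4 := abs_nonneg ((k₂ : Ω →ₘ[μ] ℝ) ω)
  refine (abs_add_le _ _).trans (le_trans ?_ (le_abs_self _))
  nlinarith [mul_nonneg b1 b4, mul_nonneg b2 b3]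

theorem ProdDominated.const_mul {X Y : BanachFunctionSpace μ} {F : Ω → ℝ}
    (hF : ProdDominated X Y F) (c : ℝ) : ProdDominated X Y (fun ω => c * F ω) := by
  obtain ⟨hFm, f, k, h⟩ := hF
  refine ⟨hFm.const_mul c, c • f, k, ?_⟩
  filter_upwards [h, X.coeFn_smul' c f] with ω h1 h2
  rw [h2, mul_assoc, abs_mul, abs_mul c]
  gcongr

theorem prodDominated_mul (X Y : BanachFunctionSpace μ) (f : X) (k : Y) :
    ProdDominated X Y (fun ω => (f : Ω →ₘ[μ] ℝ) ω * (k : Ω →ₘ[μ] ℝ) ω) :=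
  ⟨((AEEqFun.measurable _).mul (AEEqFun.measurable _)).aestronglyMeasurable, f, k,
    Eventually.of_forall fun _ => le_rfl⟩

/-- Divide by the factor whose space need not be order continuous. The quotients are dominated in
the other space and tend to `0`, so their norms do too, while the divisor stays fixed. -/
theorem exists_tendsto_of_dominated (X Y : BanachFunctionSpace μ)
    (hoc : X.SigmaOrderContinuous ∨ Y.SigmaOrderContinuous) {F : ℕ → Ω → ℝ}
    (hF : ∀ n, AEStronglyMeasurable (F n) μ) (f : X) (k : Y)
    (hle : ∀ n, ∀ᵐ ω ∂μ, |F n ω| ≤ |(f : Ω →ₘ[μ] ℝ) ω * (k : Ω →ₘ[μ] ℝ) ω|)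
    (hlim : ∀ᵐ ω ∂μ, Tendsto (fun n => F n ω) atTop (𝓝 0)) :
    ∃ (f' : ℕ → X) (k' : ℕ → Y),
      (∀ n, ∀ᵐ ω ∂μ, |F n ω| ≤ |(f' n : Ω →ₘ[μ] ℝ) ω * (k' n : Ω →ₘ[μ] ℝ) ω|) ∧
      Tendsto (fun n => ‖f' n‖ * ‖k' n‖) atTop (𝓝 0) := by
  rcases hoc with hoc | hoc
  · have hm : ∀ n, AEStronglyMeasurable (fun ω => F n ω / (k : Ω →ₘ[μ] ℝ) ω) μ := fun n =>
      ((hF n).aemeasurable.div (AEEqFun.measurable _).aemeasurable).aestronglyMeasurable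
    have hle' : ∀ n, ∀ᵐ ω ∂μ, |F n ω / (k : Ω →ₘ[μ] ℝ) ω| ≤ |(f : Ω →ₘ[μ] ℝ) ω| := by
      intro n
      filter_upwards [hle n] with ω h1
      rw [abs_div]
      rw [abs_mul] at h1
      exact div_le_of_le_mul₀ (abs_nonneg _) (abs_nonneg _) h1
    choose u hu _ using fun n => X.exists_of_abs_le (hm n) f (hle' n)
    refine ⟨u, fun _ => k, fun n => ?_, ?_⟩
    · filter_upwards [hle n, hu n] with ω h1 h2
      rw [h2]
      -- Where the divisor vanishes, so does `F n` by the domination, and the value `0` of the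
      -- quotient does no harm.
      rcases eq_or_ne ((k : Ω →ₘ[μ] ℝ) ω) 0 with h3 | h3
      · simpa [h3] using h1
      · rw [div_mul_cancel₀ _ h3]
    · have := X.tendsto_norm_zero_of_dominated hoc u f
        (fun n => by filter_upwards [hle' n, hu n] with ω h1 h2; rwa [h2]) (by
          filter_upwards [ae_all_iff.2 hu, hlim] with ω h1 h2
          simp only [h1]
          simpa using h2.div_const ((k : Ω →ₘ[μ] ℝ) ω))
      simpa using this.mul_const ‖k‖
  · have hm : ∀ n, AEStronglyMeasurable (fun ω => F n ω / (f : Ω →ₘ[μ] ℝ) ω) μ := fun n =>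
      ((hF n).aemeasurable.div (AEEqFun.measurable _).aemeasurable).aestronglyMeasurable
    have hle' : ∀ n, ∀ᵐ ω ∂μ, |F n ω / (f : Ω →ₘ[μ] ℝ) ω| ≤ |(k : Ω →ₘ[μ] ℝ) ω| := by
      intro n
      filter_upwards [hle n] with ω h1
      rw [abs_div]
      rw [abs_mul, mul_comm] at h1
      exact div_le_of_le_mul₀ (abs_nonneg _) (abs_nonneg _) h1
    choose u hu _ using fun n => Y.exists_of_abs_le (hm n) k (hle' n)
    refine ⟨fun _ => f, u, fun n => ?_, ?_⟩
    · filter_upwards [hle n, hu n] with ω h1 h2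
      rw [h2]
      rcases eq_or_ne ((f : Ω →ₘ[μ] ℝ) ω) 0 with h3 | h3
      · simpa [h3] using h1
      · rw [mul_div_cancel₀ _ h3]
    · have := Y.tendsto_norm_zero_of_dominated hoc u k
        (fun n => by filter_upwards [hle' n, hu n] with ω h1 h2; rwa [h2]) (by
          filter_upwards [ae_all_iff.2 hu, hlim] with ω h1 h2
          simp only [h1]
          simpa using h2.div_const ((f : Ω →ₘ[μ] ℝ) ω))
      simpa using this.const_mul ‖f‖

/-- A functional on the functions dominated by products, bounded by products of norms. -/
structure ProdFunctional (X Y : BanachFunctionSpace μ) where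
  toFun : (Ω → ℝ) → ℝ
  bound : ℝ
  map_add : ∀ F G, ProdDominated X Y F → ProdDominated X Y G →
    toFun (fun ω => F ω + G ω) = toFun F + toFun G
  map_const_mul : ∀ (c : ℝ) F, ProdDominated X Y F → toFun (fun ω => c * F ω) = c * toFun F
  abs_le : ∀ F, AEStronglyMeasurable F μ → ∀ (f : X) (k : Y),
    (∀ᵐ ω ∂μ, |F ω| ≤ |(f : Ω →ₘ[μ] ℝ) ω * (k : Ω →ₘ[μ] ℝ) ω|) →
      |toFun F| ≤ bound * (‖f‖ * ‖k‖)

/-! ### Integral representation of bounded functionals -/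

namespace ProdFunctional

variable {X Y : BanachFunctionSpace μ} (Φ : ProdFunctional X Y)

theorem map_sub {F G : Ω → ℝ} (hF : ProdDominated X Y F) (hG : ProdDominated X Y G) :
    Φ.toFun (fun ω => F ω - G ω) = Φ.toFun F - Φ.toFun G := by
  have h := Φ.map_add F _ hF (hG.const_mul (-1))
  rw [Φ.map_const_mul _ _ hG] at h
  rw [sub_eq_add_neg, ← neg_one_mul (Φ.toFun G), ← h]
  congr 1
  ext ω
  ring

/-- The difference is dominated by the product `0 * 0`, so the bound makes its image zero. The
functional thus respects a.e. classes although it is defined on functions. -/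
theorem congr_ae {F G : Ω → ℝ} (hF : ProdDominated X Y F) (h : F =ᵐ[μ] G) :
    Φ.toFun F = Φ.toFun G := by
  have hG : ProdDominated X Y G :=
    hF.mono (hF.1.congr h) (by filter_upwards [h] with ω h1; rw [h1])
  have h1 := Φ.abs_le _ (hF.1.sub hG.1) 0 0 (by
    filter_upwards [h] with ω h2
    rw [Pi.sub_apply, h2, sub_self, abs_zero]
    exact abs_nonneg _)
  rw [norm_zero, zero_mul, mul_zero] at h1
  have h2 := abs_nonpos_iff.1 h1
  have h3 := Φ.map_sub hF hG
  exact sub_eq_zero.1 (h3.symm.trans h2)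

/-- Dominated convergence for `Φ`: the dominating products can be chosen with norms tending to `0`.
Everything taken from order continuity below passes through this statement. -/
theorem tendsto_zero (hoc : X.SigmaOrderContinuous ∨ Y.SigmaOrderContinuous) {F : ℕ → Ω → ℝ}
    (hF : ∀ n, AEStronglyMeasurable (F n) μ) {H : Ω → ℝ} (hH : ProdDominated X Y H)
    (hle : ∀ n, ∀ᵐ ω ∂μ, |F n ω| ≤ |H ω|)
    (hlim : ∀ᵐ ω ∂μ, Tendsto (fun n => F n ω) atTop (𝓝 0)) :
    Tendsto (fun n => Φ.toFun (F n)) atTop (𝓝 0) := by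
  obtain ⟨-, f, k, hfk⟩ := hH
  obtain ⟨f', k', h1, h2⟩ := exists_tendsto_of_dominated X Y hoc hF f k
    (fun n => by filter_upwards [hle n, hfk] with ω a b; exact a.trans b) hlim
  exact squeeze_zero_norm (fun n => Φ.abs_le _ (hF n) _ _ (h1 n))
    (by simpa using h2.const_mul Φ.bound)

theorem tendsto_of_dominated (hoc : X.SigmaOrderContinuous ∨ Y.SigmaOrderContinuous)
    {F : ℕ → Ω → ℝ} (hF : ∀ n, AEStronglyMeasurable (F n) μ) {G H : Ω → ℝ}
    (hH : ProdDominated X Y H) (hle : ∀ n, ∀ᵐ ω ∂μ, |F n ω| ≤ |H ω|)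
    (hG : AEStronglyMeasurable G μ) (hGle : ∀ᵐ ω ∂μ, |G ω| ≤ |H ω|)
    (hlim : ∀ᵐ ω ∂μ, Tendsto (fun n => F n ω) atTop (𝓝 (G ω))) :
    Tendsto (fun n => Φ.toFun (F n)) atTop (𝓝 (Φ.toFun G)) := by
  have h1 := Φ.tendsto_zero hoc (F := fun n ω => F n ω - G ω) (fun n => (hF n).sub hG)
    (hH.const_mul 2) (fun n => by
      filter_upwards [hle n, hGle] with ω a b
      rw [abs_mul, abs_two]
      have := abs_sub (F n ω) (G ω)
      linarith) (by
      filter_upwards [hlim] with ω a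
      simpa using a.sub_const (G ω))
  have h2 : ∀ n, Φ.toFun (fun ω => F n ω - G ω) = Φ.toFun (F n) - Φ.toFun G := fun n =>
    Φ.map_sub (hH.mono (hF n) (hle n)) (hH.mono hG hGle)
  simp only [h2] at h1
  simpa using h1.add_const (Φ.toFun G)

theorem prodDominated_indicator {w : Ω → ℝ} (hw : ProdDominated X Y w) {A : Set Ω}
    (hA : MeasurableSet A) : ProdDominated X Y (A.indicator w) :=
  hw.mono (hw.1.indicator hA) (Eventually.of_forall fun ω => by
    by_cases h : ω ∈ A <;> simp [h])

theorem map_indicator_iUnion (hoc : X.SigmaOrderContinuous ∨ Y.SigmaOrderContinuous) {w : Ω → ℝ}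
    (hw : ProdDominated X Y w) {A : ℕ → Set Ω} (hA : ∀ n, MeasurableSet (A n))
    (hd : Pairwise (Function.onFun Disjoint A)) :
    HasSum (fun n => Φ.toFun ((A n).indicator w)) (Φ.toFun ((⋃ n, A n).indicator w)) := by
  classical
  have hsum : ∀ s : Finset ℕ, ∑ i ∈ s, Φ.toFun ((A i).indicator w)
      = Φ.toFun ((⋃ i ∈ s, A i).indicator w) := by
    intro s
    induction s using Finset.induction_on with
    | empty =>
      have := Φ.map_const_mul 0 w hw
      simp only [zero_mul] at this
      simp [this]
    | insert a s ha ih =>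
      have hdis : Disjoint (A a) (⋃ i ∈ s, A i) :=
        Set.disjoint_iUnion₂_right.2 fun i hi => hd fun h => ha (h ▸ hi)
      rw [Finset.sum_insert ha, ih, Finset.set_biUnion_insert, Set.indicator_union_of_disjoint hdis]
      exact (Φ.map_add _ _ (prodDominated_indicator hw (hA a))
        (prodDominated_indicator hw (Finset.measurableSet_biUnion s fun i _ => hA i))).symm
  rw [HasSum, SummationFilter.unconditional_filter]
  simp only [hsum]
  -- Dominated convergence handles sequences only, so the limit over finite index sets is tested
  -- along sequences of them.
  refine tendsto_of_seq_tendsto fun s hs => ?_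
  refine Φ.tendsto_of_dominated hoc (fun n => hw.1.indicator
    (Finset.measurableSet_biUnion (s n) fun i _ => hA i)) hw
    (fun n => Eventually.of_forall fun ω => ?_) (hw.1.indicator (MeasurableSet.iUnion hA))
    (Eventually.of_forall fun ω => ?_) (Eventually.of_forall fun ω => ?_)
  · by_cases h : ω ∈ ⋃ i ∈ s n, A i <;> simp only [h, Set.indicator_of_mem,
      Set.indicator_of_notMem, not_false_eq_true, le_refl, abs_zero, abs_nonneg]
  · by_cases h : ω ∈ ⋃ i, A i <;> simp only [h, Set.indicator_of_mem,
      Set.indicator_of_notMem, not_false_eq_true, le_refl, abs_zero, abs_nonneg]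
  · refine tendsto_const_nhds.congr' ?_
    by_cases h : ω ∈ ⋃ i, A i
    · obtain ⟨i, hi⟩ := Set.mem_iUnion.1 h
      filter_upwards [hs.eventually (eventually_ge_atTop {i})] with n hn
      rw [Set.indicator_of_mem h, Set.indicator_of_mem]
      exact Set.mem_biUnion (Finset.singleton_subset_iff.1 hn) hi
    · refine Eventually.of_forall fun n => ?_
      rw [Set.indicator_of_notMem h]
      refine (Set.indicator_of_notMem (fun h2 => ?_) _).symm
      obtain ⟨i, -, hi⟩ := Set.mem_iUnion₂.1 h2
      exact h (Set.mem_iUnion.2 ⟨i, hi⟩)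

open Classical in
/-- The signed measure `A ↦ Φ(1_A w)`. -/
noncomputable def signedMeasure (hoc : X.SigmaOrderContinuous ∨ Y.SigmaOrderContinuous) {w : Ω → ℝ}
    (hw : ProdDominated X Y w) : SignedMeasure Ω where
  measureOf' A := if MeasurableSet A then Φ.toFun (A.indicator w) else 0
  empty' := by
    have := Φ.map_const_mul 0 w hw
    simp only [zero_mul] at this
    simpa using this
  not_measurable' A hA := if_neg hA
  m_iUnion' A hA hd := by
    simp only [hA, if_true, MeasurableSet.iUnion hA]
    exact Φ.map_indicator_iUnion hoc hw hA hd

/-- On a `μ`-null set `A` the function `1_A w` is a.e. zero, so the signed measure `A ↦ Φ(1_A w)` is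
absolutely continuous and Radon–Nikodym applies. -/
theorem exists_density_indicator [SigmaFinite μ]
    (hoc : X.SigmaOrderContinuous ∨ Y.SigmaOrderContinuous) {w : Ω → ℝ}
    (hw : ProdDominated X Y w) :
    ∃ G : Ω → ℝ, Measurable G ∧ Integrable G μ ∧
      ∀ A, MeasurableSet A → Φ.toFun (A.indicator w) = ∫ ω in A, G ω ∂μ := by
  let s := Φ.signedMeasure hoc hw
  have hs : ∀ A, MeasurableSet A → s A = Φ.toFun (A.indicator w) := fun A hA => if_pos hA
  have hac : VectorMeasure.AbsolutelyContinuous s μ.toENNRealVectorMeasure := by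
    refine VectorMeasure.AbsolutelyContinuous.mk fun A hA hA0 => ?_
    rw [Measure.toENNRealVectorMeasure_apply_measurable hA] at hA0
    rw [hs A hA]
    have h1 : A.indicator w =ᵐ[μ] fun ω => 0 * w ω := by
      filter_upwards [measure_eq_zero_iff_ae_notMem.1 hA0] with ω h
      simp [h]
    rw [Φ.congr_ae (prodDominated_indicator hw hA) h1, Φ.map_const_mul _ _ hw, zero_mul]
  refine ⟨s.rnDeriv μ, SignedMeasure.measurable_rnDeriv s μ, SignedMeasure.integrable_rnDeriv s μ,
    fun A hA => ?_⟩
  rw [← hs A hA, ← withDensityᵥ_apply (SignedMeasure.integrable_rnDeriv s μ) hA,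
    (SignedMeasure.absolutelyContinuous_iff_withDensityᵥ_rnDeriv_eq s μ).1 hac]

theorem map_simpleFunc_mul {w G : Ω → ℝ} (hw : ProdDominated X Y w) (hG : Integrable G μ)
    (h : ∀ A, MeasurableSet A → Φ.toFun (A.indicator w) = ∫ ω in A, G ω ∂μ)
    (s : SimpleFunc Ω ℝ) :
    ProdDominated X Y (fun ω => s ω * w ω) ∧ Integrable (fun ω => s ω * G ω) μ ∧
      Φ.toFun (fun ω => s ω * w ω) = ∫ ω, s ω * G ω ∂μ := by
  classical
  induction s using SimpleFunc.induction with
  | @const c A hA =>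
    have h1 : ∀ v : Ω → ℝ, (fun ω => (SimpleFunc.piecewise A hA (SimpleFunc.const Ω c)
        (SimpleFunc.const Ω 0)) ω * v ω) = fun ω => c * A.indicator v ω := by
      intro v
      ext ω
      by_cases hω : ω ∈ A <;> simp [hω]
    rw [h1, h1]
    refine ⟨(prodDominated_indicator hw hA).const_mul c, (hG.indicator hA).const_mul c, ?_⟩
    rw [Φ.map_const_mul _ _ (prodDominated_indicator hw hA), h A hA, integral_const_mul,
      integral_indicator hA]
  | @add f g _ hf hg =>
    obtain ⟨f1, f2, f3⟩ := hf
    obtain ⟨g1, g2, g3⟩ := hg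
    have h1 : ∀ v : Ω → ℝ, (fun ω => (f + g) ω * v ω) = fun ω => f ω * v ω + g ω * v ω := by
      intro v
      ext ω
      simp [add_mul]
    rw [h1, h1]
    refine ⟨f1.add g1, f2.add g2, ?_⟩
    rw [Φ.map_add _ _ f1 g1, f3, g3, integral_add f2 g2]

/-- A functional bounded by products of norms is integration against a measurable function, if one
of the factors is `σ`-order continuous. -/
theorem exists_density [SigmaFinite μ] (hX : Saturated X.carrier) (hY : Saturated Y.carrier)
    (hoc : X.SigmaOrderContinuous ∨ Y.SigmaOrderContinuous) :
    ∃ g : Ω → ℝ, Measurable g ∧ ∀ F, ProdDominated X Y F →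
      Integrable (fun ω => F ω * g ω) μ ∧ Φ.toFun F = ∫ ω, F ω * g ω ∂μ := by
  obtain ⟨f₀, hf₀⟩ := X.exists_ae_pos hX
  obtain ⟨k₀, hk₀⟩ := Y.exists_ae_pos hY
  -- A product of weak units is a.e. nonzero, so densities relative to it can be divided by it: the
  -- candidate is `G / w`.
  let w : Ω → ℝ := fun ω => (f₀ : Ω →ₘ[μ] ℝ) ω * (k₀ : Ω →ₘ[μ] ℝ) ω
  have hw : ProdDominated X Y w := prodDominated_mul X Y f₀ k₀
  have hw0 : ∀ᵐ ω ∂μ, w ω ≠ 0 := by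
    filter_upwards [hf₀, hk₀] with ω h1 h2
    exact (mul_pos h1 h2).ne'
  have hwm : Measurable w := (AEEqFun.measurable _).mul (AEEqFun.measurable _)
  obtain ⟨G, hGm, hG, hGA⟩ := Φ.exists_density_indicator hoc hw
  have hsimple := Φ.map_simpleFunc_mul hw hG hGA
  refine ⟨fun ω => G ω / w ω, hGm.div hwm, fun F hF => ?_⟩
  obtain ⟨f, k, hfk⟩ := hF.2
  have hrm : AEMeasurable (fun ω => F ω / w ω) μ := hF.1.aemeasurable.div hwm.aemeasurable
  obtain ⟨r, hr, hFr⟩ := hrm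
  -- Approximate the ratio `F / w` rather than `F`. Then `|s n| ≤ 2 |F / w|`, so that `s n * w` is
  -- dominated by `2 F`.
  let s : ℕ → SimpleFunc Ω ℝ := fun n => SimpleFunc.approxOn r hr Set.univ 0 (Set.mem_univ _) n
  have hslim : ∀ ω, Tendsto (fun n => s n ω) atTop (𝓝 (r ω)) := fun ω =>
    SimpleFunc.tendsto_approxOn hr _ (by simp)
  have hsle : ∀ n ω, |s n ω| ≤ 2 * |r ω| := by
    intro n ω
    have := SimpleFunc.norm_approxOn_zero_le hr (Set.mem_univ 0) ω n
    rw [Real.norm_eq_abs, Real.norm_eq_abs] at this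
    change |s n ω| ≤ _ at this
    linarith
  have hrF : ∀ᵐ ω ∂μ, r ω * w ω = F ω := by
    filter_upwards [hFr, hw0] with ω h1 h2
    rw [← h1, div_mul_cancel₀ _ h2]
  have hswle : ∀ᵐ ω ∂μ, ∀ n, |s n ω * w ω| ≤ |2 * F ω| := by
    filter_upwards [hrF] with ω h1 n
    rw [← h1]
    generalize w ω = y
    rw [abs_mul, abs_mul, abs_mul, abs_two, ← mul_assoc]
    exact mul_le_mul_of_nonneg_right (hsle n ω) (abs_nonneg _)
  have hGlim : ∀ᵐ ω ∂μ, Tendsto (fun n => s n ω * G ω) atTop (𝓝 (F ω * (G ω / w ω))) := by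
    filter_upwards [hrF, hw0] with ω h1 h2
    have h3 : F ω * (G ω / w ω) = r ω * G ω := by
      rw [← h1]; field_simp
    rw [h3]
    exact (hslim ω).mul_const _
  have hbd : ∀ n, ∫ ω, |s n ω * G ω| ∂μ ≤ Φ.bound * (‖(2 : ℝ) • f‖ * ‖k‖) := by
    intro n
    -- Flipping signs gives `t G = |s n G|` while `|t w| = |s n w|`, so the bound on `Φ` controls
    -- the `L¹` norm of `s n * G` uniformly in `n`.
    let t : SimpleFunc Ω ℝ := SimpleFunc.piecewise {ω | 0 ≤ s n ω * G ω}
      (measurableSet_le measurable_const ((s n).measurable.mul hGm)) (s n) (-(s n))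
    obtain ⟨t1, t2, t3⟩ := hsimple t
    have h1 : ∀ ω, t ω * G ω = |s n ω * G ω| := by
      intro ω
      by_cases h : 0 ≤ s n ω * G ω
      · rw [abs_of_nonneg h]
        simp [t, SimpleFunc.coe_piecewise, Set.piecewise, h]
      · rw [abs_of_neg (not_le.1 h)]
        simp [t, SimpleFunc.coe_piecewise, Set.piecewise, h]
    simp only [h1] at t3
    rw [← t3]
    refine (le_abs_self _).trans (Φ.abs_le _ t1.1 _ _ ?_)
    filter_upwards [hswle, hfk, X.coeFn_smul' 2 f] with ω h2 h3 h4
    have h5 : |t ω * w ω| = |s n ω * w ω| := by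
      by_cases h : 0 ≤ s n ω * G ω <;>
        simp [t, SimpleFunc.coe_piecewise, Set.piecewise, h, abs_mul]
    rw [h5, h4, mul_assoc, abs_mul 2]
    refine (h2 n).trans ?_
    rw [abs_mul]
    gcongr
  have hint : Integrable (fun ω => F ω * (G ω / w ω)) μ :=
    integrable_of_tendsto_of_integral_le (fun n => (hsimple (s n)).2.1) hbd hGlim
  refine ⟨hint, ?_⟩
  have hl1 : Tendsto (fun n => ∫ ω, s n ω * G ω ∂μ) atTop (𝓝 (∫ ω, F ω * (G ω / w ω) ∂μ)) := by
    refine tendsto_integral_of_dominated_convergence (fun ω => 2 * |F ω * (G ω / w ω)|)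
      (fun n => (hsimple (s n)).2.1.1) (hint.abs.const_mul 2) (fun n => ?_) hGlim
    filter_upwards [hrF, hw0] with ω h1 h2
    have h3 : F ω * (G ω / w ω) = r ω * G ω := by
      rw [← h1]; field_simp
    rw [h3, Real.norm_eq_abs, abs_mul, abs_mul, ← mul_assoc]
    exact mul_le_mul_of_nonneg_right (hsle n ω) (abs_nonneg _)
  have hl2 : Tendsto (fun n => Φ.toFun (fun ω => s n ω * w ω)) atTop (𝓝 (Φ.toFun F)) := by
    refine Φ.tendsto_of_dominated hoc (fun n => (hsimple (s n)).1.1) (hF.const_mul 2)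
      (fun n => ?_) hF.1 ?_ ?_
    · filter_upwards [hswle] with ω h1 using h1 n
    · refine Eventually.of_forall fun ω => ?_
      rw [abs_mul, abs_two]
      linarith [abs_nonneg (F ω)]
    · filter_upwards [hrF] with ω h1
      rw [← h1]
      exact (hslim ω).mul_const _
  simp only [fun n => (hsimple (s n)).2.2] at hl2
  exact tendsto_nhds_unique hl2 hl1

end ProdFunctional

end Product

/-! ### The product norm and its dual -/

section ProductNorm

variable {Ω : Type*} [MeasurableSpace Ω] {μ : Measure Ω}

/-- The functions dominated by a product of an element of `X` and an element of `Y`. -/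
def prodSpace (X Y : BanachFunctionSpace μ) : Submodule ℝ (Ω →ₘ[μ] ℝ) where
  carrier := {u | ProdDominated X Y u}
  add_mem' {u v} hu hv := (hu.add hv).mono (AEEqFun.aestronglyMeasurable _) (by
    filter_upwards [AEEqFun.coeFn_add u v] with ω h
    rw [h, Pi.add_apply])
  zero_mem' := by
    refine ⟨AEEqFun.aestronglyMeasurable _, 0, 0, ?_⟩
    filter_upwards [AEEqFun.coeFn_zero (α := Ω) (μ := μ) (β := ℝ)] with ω h
    rw [h, Pi.zero_apply, abs_zero]
    exact abs_nonneg _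
  smul_mem' c u hu := (hu.const_mul c).mono (AEEqFun.aestronglyMeasurable _) (by
    filter_upwards [AEEqFun.coeFn_smul c u] with ω h
    rw [h, Pi.smul_apply, smul_eq_mul])

theorem mul_mem_prodSpace (X Y : BanachFunctionSpace μ) (f : X) (k : Y) :
    (f : Ω →ₘ[μ] ℝ) * (k : Ω →ₘ[μ] ℝ) ∈ prodSpace X Y :=
  (prodDominated_mul X Y f k).mono (AEEqFun.aestronglyMeasurable _) (by
    filter_upwards [AEEqFun.coeFn_mul (f : Ω →ₘ[μ] ℝ) k] with ω h
    rw [h, Pi.mul_apply])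

theorem enorm_le_enorm_of_abs_le {a b : ℝ} (h : |a| ≤ |b|) : ‖a‖ₑ ≤ ‖b‖ₑ := by
  rw [Real.enorm_eq_ofReal_abs, Real.enorm_eq_ofReal_abs]
  exact ENNReal.ofReal_le_ofReal h

theorem mul_norm_mem_piSums (X Y : BanachFunctionSpace μ) {u : Ω →ₘ[μ] ℝ} (f : X) (k : Y)
    (h : ∀ᵐ ω ∂μ, |u ω| ≤ |(f : Ω →ₘ[μ] ℝ) ω * (k : Ω →ₘ[μ] ℝ) ω|) :
    ‖f‖ * ‖k‖ ∈ piSums X Y u := by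
  refine ⟨Pi.single 0 f, fun _ => k, ?_, ?_⟩
  · have := hasSum_single (f := fun n => ‖(Pi.single 0 f : ℕ → X) n‖ * ‖k‖) 0 fun n hn => by
      simp [Pi.single_eq_of_ne hn]
    simpa using this
  · filter_upwards [h] with ω h1
    refine (enorm_le_enorm_of_abs_le h1).trans ?_
    have := ENNReal.le_tsum (f := fun n => ‖((Pi.single 0 f : ℕ → X) n : Ω →ₘ[μ] ℝ) ω
      * (k : Ω →ₘ[μ] ℝ) ω‖ₑ) 0
    simpa using this

theorem piSums_nonempty {X Y : BanachFunctionSpace μ} {u : Ω →ₘ[μ] ℝ} (hu : u ∈ prodSpace X Y) :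
    (piSums X Y u).Nonempty := by
  obtain ⟨-, f, k, h⟩ := hu
  exact ⟨_, mul_norm_mem_piSums X Y f k h⟩

theorem bddBelow_piSums (X Y : BanachFunctionSpace μ) (u : Ω →ₘ[μ] ℝ) :
    BddBelow (piSums X Y u) := by
  refine ⟨0, ?_⟩
  rintro c ⟨f, k, hc, -⟩
  exact hc.nonneg fun n => by positivity

theorem piNorm_le_of_mem {X Y : BanachFunctionSpace μ} {u : Ω →ₘ[μ] ℝ} {c : ℝ}
    (hc : c ∈ piSums X Y u) : piNorm X Y u ≤ c :=
  csInf_le (bddBelow_piSums X Y u) hc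

/-- Interleave the two representations along the even and the odd indices. -/
theorem add_mem_piSums {X Y : BanachFunctionSpace μ} {u v : Ω →ₘ[μ] ℝ} {a b : ℝ}
    (ha : a ∈ piSums X Y u) (hb : b ∈ piSums X Y v) : a + b ∈ piSums X Y (u + v) := by
  obtain ⟨f₁, k₁, h₁, hu⟩ := ha
  obtain ⟨f₂, k₂, h₂, hv⟩ := hb
  let f : ℕ → X := fun n => if Even n then f₁ (n / 2) else f₂ (n / 2)
  let k : ℕ → Y := fun n => if Even n then k₁ (n / 2) else k₂ (n / 2)
  have hf0 : ∀ n, f (2 * n) = f₁ n := fun n => by simp [f]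
  have hk0 : ∀ n, k (2 * n) = k₁ n := fun n => by simp [k]
  have hf1 : ∀ n, f (2 * n + 1) = f₂ n := fun n => by
    simp [f, show (2 * n + 1) / 2 = n by omega]
  have hk1 : ∀ n, k (2 * n + 1) = k₂ n := fun n => by
    simp [k, show (2 * n + 1) / 2 = n by omega]
  refine ⟨f, k, HasSum.even_add_odd (by simpa only [hf0, hk0] using h₁)
    (by simpa only [hf1, hk1] using h₂), ?_⟩
  filter_upwards [hu, hv, AEEqFun.coeFn_add u v] with ω a1 a2 a3
  rw [a3, Pi.add_apply, ← tsum_even_add_odd ENNReal.summable ENNReal.summable]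
  simp only [hf0, hk0, hf1, hk1]
  exact (enorm_add_le _ _).trans (add_le_add a1 a2)

theorem smul_mem_piSums {X Y : BanachFunctionSpace μ} {u : Ω →ₘ[μ] ℝ} {a c : ℝ} (hc : 0 < c)
    (ha : a ∈ piSums X Y u) : c * a ∈ piSums X Y (c • u) := by
  obtain ⟨f, k, h, hu⟩ := ha
  refine ⟨fun n => c • f n, k, ?_, ?_⟩
  · have := h.mul_left c
    simpa only [_root_.norm_smul, Real.norm_of_nonneg hc.le, mul_assoc] using this
  · filter_upwards [hu, AEEqFun.coeFn_smul c u,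
      ae_all_iff.2 fun n => X.coeFn_smul' c (f n)] with ω a1 a2 a3
    simp only [a2, a3, Pi.smul_apply, smul_eq_mul, mul_assoc]
    rw [enorm_mul]
    simp only [enorm_mul c]
    rw [ENNReal.tsum_mul_left]
    gcongr

theorem piNorm_add_le {X Y : BanachFunctionSpace μ} {u v : Ω →ₘ[μ] ℝ} (hu : u ∈ prodSpace X Y)
    (hv : v ∈ prodSpace X Y) : piNorm X Y (u + v) ≤ piNorm X Y u + piNorm X Y v := by
  have h1 : ∀ b ∈ piSums X Y v, piNorm X Y (u + v) - b ≤ piNorm X Y u := fun b hb =>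
    le_csInf (piSums_nonempty hu) fun a ha => by
      linarith [piNorm_le_of_mem (add_mem_piSums ha hb)]
  have h2 : piNorm X Y (u + v) - piNorm X Y u ≤ piNorm X Y v :=
    le_csInf (piSums_nonempty hv) fun b hb => by linarith [h1 b hb]
  linarith

theorem piNorm_smul {X Y : BanachFunctionSpace μ} {u : Ω →ₘ[μ] ℝ} (hu : u ∈ prodSpace X Y) {c : ℝ}
    (hc : 0 < c) : piNorm X Y (c • u) = c * piNorm X Y u := by
  have key : ∀ {u : Ω →ₘ[μ] ℝ} (_ : u ∈ prodSpace X Y) {c : ℝ}, 0 < c →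
      piNorm X Y (c • u) ≤ c * piNorm X Y u := by
    intro u hu c hc
    rw [← div_le_iff₀' hc]
    refine le_csInf (piSums_nonempty hu) fun a ha => ?_
    rw [div_le_iff₀' hc]
    exact piNorm_le_of_mem (smul_mem_piSums hc ha)
  refine le_antisymm (key hu hc) ?_
  have := key ((prodSpace X Y).smul_mem c hu) (inv_pos.2 hc)
  rwa [inv_smul_smul₀ hc.ne', ← div_eq_inv_mul, le_div_iff₀' hc] at this

theorem coeFn_sum_range (u : ℕ → Ω →ₘ[μ] ℝ) (n : ℕ) :
    (∑ i ∈ Finset.range n, u i : Ω →ₘ[μ] ℝ) =ᵐ[μ] fun ω => ∑ i ∈ Finset.range n, u i ω := by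
  induction n with
  | zero =>
    filter_upwards [AEEqFun.coeFn_zero (α := Ω) (μ := μ) (β := ℝ)] with ω h
    simpa using h
  | succ n ih =>
    filter_upwards [ih, AEEqFun.coeFn_add (∑ i ∈ Finset.range n, u i) (u n)] with ω h1 h2
    rw [Finset.sum_range_succ, Finset.sum_range_succ, h2, Pi.add_apply, h1]

/-- A function that multiplies all products of elements of `X` and `Y` into `L¹` does so
boundedly. -/
theorem exists_bilinear_bound (X Y : BanachFunctionSpace μ) (g : Ω → ℝ)
    (hg : ∀ (f : X) (k : Y),
      Integrable (fun ω => (f : Ω →ₘ[μ] ℝ) ω * (k : Ω →ₘ[μ] ℝ) ω * g ω) μ) :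
    ∃ C : ℝ, 0 < C ∧ ∀ (f : X) (k : Y),
      ∫ ω, |(f : Ω →ₘ[μ] ℝ) ω * (k : Ω →ₘ[μ] ℝ) ω * g ω| ∂μ ≤ C * (‖f‖ * ‖k‖) := by
  by_contra! hcon
  -- The factor `4 ^ n` pays for the weights `2⁻ⁿ` in both dominating series, and the remaining `2 ^
  -- n` makes the integral of the dominating product infinite.
  choose f k hfk using fun n : ℕ => hcon (4 ^ n * 2 ^ n) (by positivity)
  have hf : ∀ n, 0 < ‖f n‖ := by
    intro n
    rw [norm_pos_iff]
    intro h0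
    have h1 := hfk n
    rw [h0, norm_zero, zero_mul, mul_zero] at h1
    refine h1.ne' (integral_eq_zero_of_ae ?_)
    filter_upwards [X.coeFn_zero'] with ω h2
    rw [h2]
    simp
  have hk : ∀ n, 0 < ‖k n‖ := by
    intro n
    rw [norm_pos_iff]
    intro h0
    have h1 := hfk n
    rw [h0, norm_zero, mul_zero, mul_zero] at h1
    refine h1.ne' (integral_eq_zero_of_ae ?_)
    filter_upwards [Y.coeFn_zero'] with ω h2
    rw [h2]
    simp
  have hdom : ∀ (Z : BanachFunctionSpace μ) (z : ℕ → Z), (∀ n, 0 < ‖z n‖) →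
      ∃ V : Z, ∀ n, ∀ᵐ ω ∂μ,
        (2 : ℝ)⁻¹ ^ n * ‖z n‖⁻¹ * |(z n : Ω →ₘ[μ] ℝ) ω| ≤ (V : Ω →ₘ[μ] ℝ) ω := by
    intro Z z hz
    have hc : ∀ n, 0 < (2 : ℝ)⁻¹ ^ n * ‖z n‖⁻¹ := fun n => by have := hz n; positivity
    obtain ⟨V, hV⟩ := Z.exists_dominating (fun n => ((2 : ℝ)⁻¹ ^ n * ‖z n‖⁻¹) • z n) (by
      refine (summable_geometric_of_lt_one (r := (2 : ℝ)⁻¹) (by norm_num) (by norm_num)).congr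
        fun n => ?_
      rw [_root_.norm_smul, Real.norm_of_nonneg (hc n).le, mul_assoc,
        inv_mul_cancel₀ (hz n).ne', mul_one])
    refine ⟨V, fun n => ?_⟩
    filter_upwards [hV n, Z.coeFn_smul' ((2 : ℝ)⁻¹ ^ n * ‖z n‖⁻¹) (z n)] with ω h1 h2
    rwa [h2, abs_mul, abs_of_pos (hc n)] at h1
  obtain ⟨U, hU⟩ := hdom X f hf
  obtain ⟨V, hV⟩ := hdom Y k hk
  have hbig : ∀ n : ℕ, (2 : ℝ) ^ n ≤
      ∫ ω, |(U : Ω →ₘ[μ] ℝ) ω * (V : Ω →ₘ[μ] ℝ) ω * g ω| ∂μ := by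
    intro n
    have hfn := hf n
    have hkn := hk n
    have h1 : ((2 : ℝ)⁻¹ ^ n * ‖f n‖⁻¹ * ((2 : ℝ)⁻¹ ^ n * ‖k n‖⁻¹)) *
        ∫ ω, |(f n : Ω →ₘ[μ] ℝ) ω * (k n : Ω →ₘ[μ] ℝ) ω * g ω| ∂μ ≤
        ∫ ω, |(U : Ω →ₘ[μ] ℝ) ω * (V : Ω →ₘ[μ] ℝ) ω * g ω| ∂μ := by
      rw [← integral_const_mul]
      apply integral_mono_ae ((hg _ _).abs.const_mul _) (hg U V).abs
      filter_upwards [hU n, hV n] with ω a b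
      simp only [abs_mul]
      calc _ = ((2 : ℝ)⁻¹ ^ n * ‖f n‖⁻¹ * |(f n : Ω →ₘ[μ] ℝ) ω|) *
            ((2 : ℝ)⁻¹ ^ n * ‖k n‖⁻¹ * |(k n : Ω →ₘ[μ] ℝ) ω|) * |g ω| := by ring
        _ ≤ |(U : Ω →ₘ[μ] ℝ) ω| * |(V : Ω →ₘ[μ] ℝ) ω| * |g ω| := by
          gcongr
          · exact a.trans (le_abs_self _)
          · exact b.trans (le_abs_self _)
    refine le_trans ?_ h1
    have h2 : (2 : ℝ) ^ n = ((2 : ℝ)⁻¹ ^ n * ‖f n‖⁻¹ * ((2 : ℝ)⁻¹ ^ n * ‖k n‖⁻¹)) *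
        (4 ^ n * 2 ^ n * (‖f n‖ * ‖k n‖)) := by
      have h3 : (2 : ℝ)⁻¹ ^ n * (2 : ℝ)⁻¹ ^ n * 4 ^ n = 1 := by
        rw [← mul_pow, ← mul_pow]; norm_num
      calc (2 : ℝ) ^ n = ((2 : ℝ)⁻¹ ^ n * (2 : ℝ)⁻¹ ^ n * 4 ^ n) * 2 ^ n *
            (‖f n‖⁻¹ * ‖f n‖) * (‖k n‖⁻¹ * ‖k n‖) := by
              rw [h3, inv_mul_cancel₀ hfn.ne', inv_mul_cancel₀ hkn.ne']; ring
        _ = _ := by ring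
    rw [h2]
    exact mul_le_mul_of_nonneg_left (by simpa using (hfk n).le) (by positivity)
  obtain ⟨n, hn⟩ := pow_unbounded_of_one_lt
    (∫ ω, |(U : Ω →ₘ[μ] ℝ) ω * (V : Ω →ₘ[μ] ℝ) ω * g ω| ∂μ) (one_lt_two : (1 : ℝ) < 2)
  exact absurd (hbig n) (not_le.2 hn)

theorem integrable_mul_of_mem_prodSpace {X Y : BanachFunctionSpace μ} {g : Ω → ℝ}
    (hgm : AEStronglyMeasurable g μ)
    (hg : ∀ (f : X) (k : Y),
      Integrable (fun ω => (f : Ω →ₘ[μ] ℝ) ω * (k : Ω →ₘ[μ] ℝ) ω * g ω) μ)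
    {u : Ω →ₘ[μ] ℝ} (hu : u ∈ prodSpace X Y) : Integrable (fun ω => u ω * g ω) μ := by
  obtain ⟨-, f, k, h⟩ := hu
  refine (hg f k).mono ((AEEqFun.aestronglyMeasurable u).mul hgm) ?_
  filter_upwards [h] with ω h1
  rw [norm_mul, norm_mul]
  exact mul_le_mul_of_nonneg_right h1 (norm_nonneg _)

/-- Integrate a representation of `u` term by term, use the bilinear bound on each term, and take
the infimum over representations. -/
theorem exists_integral_le_piNorm (X Y : BanachFunctionSpace μ) {g : Ω → ℝ}
    (hgm : AEStronglyMeasurable g μ)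
    (hg : ∀ (f : X) (k : Y),
      Integrable (fun ω => (f : Ω →ₘ[μ] ℝ) ω * (k : Ω →ₘ[μ] ℝ) ω * g ω) μ) :
    ∃ C : ℝ, 0 < C ∧ ∀ u ∈ prodSpace X Y, ∫ ω, |u ω * g ω| ∂μ ≤ C * piNorm X Y u := by
  obtain ⟨C, hC, hb⟩ := exists_bilinear_bound X Y g hg
  refine ⟨C, hC, fun u hu => ?_⟩
  rw [← div_le_iff₀' hC]
  refine le_csInf (piSums_nonempty hu) ?_
  rintro c ⟨f, k, hc, hle⟩
  rw [div_le_iff₀' hC]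
  have hc0 : 0 ≤ c := hc.nonneg fun n => by positivity
  refine (ENNReal.ofReal_le_ofReal_iff (by positivity)).1 ?_
  have h1 := ofReal_integral_norm_eq_lintegral_enorm (integrable_mul_of_mem_prodSpace hgm hg hu)
  simp only [Real.norm_eq_abs] at h1
  rw [h1]
  calc ∫⁻ ω, ‖u ω * g ω‖ₑ ∂μ
      ≤ ∫⁻ ω, ∑' n, ‖(f n : Ω →ₘ[μ] ℝ) ω * (k n : Ω →ₘ[μ] ℝ) ω * g ω‖ₑ ∂μ := by
        apply lintegral_mono_ae
        filter_upwards [hle] with ω h2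
        simp only [enorm_mul _ (g ω)]
        rw [ENNReal.tsum_mul_right]
        gcongr
    _ = ∑' n, ∫⁻ ω, ‖(f n : Ω →ₘ[μ] ℝ) ω * (k n : Ω →ₘ[μ] ℝ) ω * g ω‖ₑ ∂μ :=
        lintegral_tsum fun n => (hg (f n) (k n)).1.enorm
    _ ≤ ∑' n, ENNReal.ofReal (C * (‖f n‖ * ‖k n‖)) := by
        refine ENNReal.tsum_le_tsum fun n => ?_
        have h2 := ofReal_integral_norm_eq_lintegral_enorm (hg (f n) (k n))
        simp only [Real.norm_eq_abs] at h2
        rw [← h2]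
        exact ENNReal.ofReal_le_ofReal (hb _ _)
    _ = ENNReal.ofReal (C * c) := by
        have h3 := hc.mul_left C
        rw [← h3.tsum_eq, ENNReal.ofReal_tsum_of_nonneg (fun n => by positivity) h3.summable]

open Classical in
/-- The `ProdFunctional` of a bounded linear functional on `prodSpace X Y`. -/
noncomputable def prodFunctionalOfLinear {X Y : BanachFunctionSpace μ} (φ : prodSpace X Y →ₗ[ℝ] ℝ)
    (C : ℝ) (hφ : ∀ (u : prodSpace X Y) (f : X) (k : Y),
      (∀ᵐ ω ∂μ, |(u : Ω →ₘ[μ] ℝ) ω| ≤ |(f : Ω →ₘ[μ] ℝ) ω * (k : Ω →ₘ[μ] ℝ) ω|) →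
        |φ u| ≤ C * (‖f‖ * ‖k‖)) : ProdFunctional X Y :=
  have hmk : ∀ {F : Ω → ℝ} (hF : ProdDominated X Y F), AEEqFun.mk F hF.1 ∈ prodSpace X Y :=
    fun hF => hF.mono (AEEqFun.aestronglyMeasurable _) (by
      filter_upwards [AEEqFun.coeFn_mk _ hF.1] with ω h
      rw [h])
  { toFun := fun F => if hF : ProdDominated X Y F then φ ⟨AEEqFun.mk F hF.1, hmk hF⟩ else 0
    bound := C
    map_add := fun F G hF hG => by
      rw [dif_pos hF, dif_pos hG, dif_pos (hF.add hG), ← map_add]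
      congr 1
    map_const_mul := fun c F hF => by
      rw [dif_pos hF, dif_pos (hF.const_mul c), ← smul_eq_mul c (φ _), ← map_smul]
      congr 1
    abs_le := fun F hFm f k h => by
      have hF : ProdDominated X Y F := ⟨hFm, f, k, h⟩
      rw [dif_pos hF]
      refine hφ _ f k ?_
      filter_upwards [AEEqFun.coeFn_mk _ hF.1, h] with ω a b
      rwa [a] }

theorem prodFunctionalOfLinear_apply {X Y : BanachFunctionSpace μ} (φ : prodSpace X Y →ₗ[ℝ] ℝ)
    (C : ℝ) (hφ : ∀ (u : prodSpace X Y) (f : X) (k : Y),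
      (∀ᵐ ω ∂μ, |(u : Ω →ₘ[μ] ℝ) ω| ≤ |(f : Ω →ₘ[μ] ℝ) ω * (k : Ω →ₘ[μ] ℝ) ω|) →
        |φ u| ≤ C * (‖f‖ * ‖k‖)) (u : prodSpace X Y) :
    (prodFunctionalOfLinear φ C hφ).toFun (u : Ω →ₘ[μ] ℝ) = φ u := by
  have hu : ProdDominated X Y (u : Ω →ₘ[μ] ℝ) := u.2
  unfold prodFunctionalOfLinear
  dsimp only
  rw [dif_pos hu]
  congr 1
  exact Subtype.ext (AEEqFun.mk_coeFn _)

/-- A linear functional dominated by the product norm is integration against a measurable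
function, if one of the factors is `σ`-order continuous. -/
theorem exists_density_of_le_piNorm [SigmaFinite μ] {X Y : BanachFunctionSpace μ}
    (hX : Saturated X.carrier) (hY : Saturated Y.carrier)
    (hoc : X.SigmaOrderContinuous ∨ Y.SigmaOrderContinuous) (φ : prodSpace X Y →ₗ[ℝ] ℝ) {C : ℝ}
    (hC : 0 ≤ C) (hφ : ∀ u, φ u ≤ C * piNorm X Y u) :
    ∃ g : Ω → ℝ, Measurable g ∧ ∀ u : prodSpace X Y,
      Integrable (fun ω => (u : Ω →ₘ[μ] ℝ) ω * g ω) μ ∧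
        φ u = ∫ ω, (u : Ω →ₘ[μ] ℝ) ω * g ω ∂μ := by
  have hb : ∀ (u : prodSpace X Y) (f : X) (k : Y),
      (∀ᵐ ω ∂μ, |(u : Ω →ₘ[μ] ℝ) ω| ≤ |(f : Ω →ₘ[μ] ℝ) ω * (k : Ω →ₘ[μ] ℝ) ω|) →
        φ u ≤ C * (‖f‖ * ‖k‖) := fun u f k h =>
    (hφ u).trans (mul_le_mul_of_nonneg_left (piNorm_le_of_mem (mul_norm_mem_piSums X Y f k h)) hC)
  let Φ := prodFunctionalOfLinear φ C fun u f k h => by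
    refine abs_le'.2 ⟨hb u f k h, ?_⟩
    rw [← map_neg]
    refine hb (-u) f k ?_
    filter_upwards [h, AEEqFun.coeFn_neg (u : Ω →ₘ[μ] ℝ)] with ω h1 h2
    have h3 : ((-u : prodSpace X Y) : Ω →ₘ[μ] ℝ) ω = - (u : Ω →ₘ[μ] ℝ) ω := h2
    rwa [h3, abs_neg]
  obtain ⟨g, hgm, hg⟩ := Φ.exists_density hX hY hoc
  refine ⟨g, hgm, fun u => ⟨(hg u u.2).1, ?_⟩⟩
  rw [← (hg u u.2).2]
  exact (prodFunctionalOfLinear_apply φ C _ u).symm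

/-- A linear functional `ψ` on a vector space that is dominated by the product norm of a linear
image in `prodSpace X Y` is given by integration. -/
theorem exists_density_of_comp_le_piNorm [SigmaFinite μ] {X Y : BanachFunctionSpace μ}
    (hX : Saturated X.carrier) (hY : Saturated Y.carrier)
    (hoc : X.SigmaOrderContinuous ∨ Y.SigmaOrderContinuous) {E : Type*} [AddCommGroup E]
    [Module ℝ E] (L : E →ₗ[ℝ] prodSpace X Y) (ψ : E →ₗ[ℝ] ℝ) {C : ℝ} (hC : 0 ≤ C)
    (hψ : ∀ x, ψ x ≤ C * piNorm X Y (L x)) :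
    ∃ g : Ω → ℝ, Measurable g ∧
      (∀ u ∈ prodSpace X Y, Integrable (fun ω => u ω * g ω) μ) ∧
      ∀ x, ψ x = ∫ ω, (L x : Ω →ₘ[μ] ℝ) ω * g ω ∂μ := by
  have h0 : piNorm X Y 0 ≤ 0 := by
    have := piNorm_le_of_mem (mul_norm_mem_piSums X Y (u := 0) 0 0 (by
      filter_upwards [AEEqFun.coeFn_zero (α := Ω) (μ := μ) (β := ℝ)] with ω h
      rw [h, Pi.zero_apply, abs_zero]
      exact abs_nonneg _))
    simpa using this
  have hker : ∀ x, L x = 0 → ψ x ≤ 0 := by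
    intro x hx
    refine (hψ x).trans ?_
    rw [hx]
    exact mul_nonpos_of_nonneg_of_nonpos hC h0
  have hmem : ψ ∈ (LinearMap.ker L).dualAnnihilator := by
    rw [Submodule.mem_dualAnnihilator]
    intro x hx
    rw [LinearMap.mem_ker] at hx
    refine le_antisymm (hker x hx) ?_
    have := hker (-x) (by rw [map_neg, hx, neg_zero])
    rw [map_neg] at this
    linarith
  rw [← LinearMap.range_dualMap_eq_dualAnnihilator_ker] at hmem
  obtain ⟨φ₀, hφ₀⟩ := hmem
  have hφ₀' : ∀ x, φ₀ (L x) = ψ x := fun x => by rw [← hφ₀]; rfl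
  -- The algebraic factorization `φ₀` is controlled only on the range of `L`; it is restricted there
  -- and extended anew under the sublinear bound.
  obtain ⟨φ, hφ, hφle⟩ := exists_extension_of_le_sublinear
    ⟨LinearMap.range L, φ₀.domRestrict (LinearMap.range L)⟩
    (fun u : prodSpace X Y => C * piNorm X Y u)
    (fun c hc u => by
      change C * piNorm X Y (c • (u : Ω →ₘ[μ] ℝ)) = _
      rw [piNorm_smul u.2 hc]
      ring)
    (fun u v => by
      rw [← mul_add]
      exact mul_le_mul_of_nonneg_left (piNorm_add_le u.2 v.2) hC)
    (by
      rintro ⟨_, x, rfl⟩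
      exact (hφ₀' x).le.trans (hψ x))
  obtain ⟨g, hgm, hg⟩ := exists_density_of_le_piNorm hX hY hoc φ hC hφle
  refine ⟨g, hgm, fun u hu => (hg ⟨u, hu⟩).1, fun x => ?_⟩
  rw [← (hg (L x)).2, ← hφ₀' x]
  exact (hφ ⟨L x, LinearMap.mem_range_self L x⟩).symm

/-- Integration against `d` as a continuous linear functional. -/
theorem exists_integral_functional (Z : BanachFunctionSpace μ) {d : Ω →ₘ[μ] ℝ}
    (hd : d ∈ kotheSet Z.carrier) :
    ∃ ℓ : Z →L[ℝ] ℝ, ∀ k : Z, ℓ k = ∫ ω, (k : Ω →ₘ[μ] ℝ) ω * d ω ∂μ := by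
  have hd' := mem_kotheSet.1 hd
  obtain ⟨M, hM⟩ := Z.exists_bound hd
  let ℓ : Z →ₗ[ℝ] ℝ :=
    { toFun := fun k => ∫ ω, (k : Ω →ₘ[μ] ℝ) ω * d ω ∂μ
      map_add' := fun k l => by
        rw [← integral_add (hd' k k.2) (hd' l l.2)]
        apply integral_congr_ae
        filter_upwards [Z.coeFn_add' k l] with ω h
        rw [h, add_mul]
      map_smul' := fun c k => by
        rw [RingHom.id_apply, smul_eq_mul, ← integral_const_mul]
        apply integral_congr_ae
        filter_upwards [Z.coeFn_smul' c k] with ω h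
        rw [h, mul_assoc] }
  refine ⟨ℓ.mkContinuous M fun k => ?_, fun k => rfl⟩
  exact (norm_integral_le_integral_norm _).trans (hM k)

/-- Integration against `d` is continuous, so it vanishes on all of `Z` through the basis expansion.
Testing it on a weak unit multiplied by the sign of `d` gives `d = 0`. -/
theorem eq_zero_of_integral_basis_eq_zero [SigmaFinite μ] {Z : BanachFunctionSpace μ}
    (hZ : Saturated Z.carrier) (γ : SchauderBasis ℝ Z) {d : Ω →ₘ[μ] ℝ}
    (hd : d ∈ kotheSet Z.carrier)
    (h : ∀ i, ∫ ω, (γ i : Ω →ₘ[μ] ℝ) ω * d ω ∂μ = 0) : d = 0 := by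
  obtain ⟨ℓ, hℓ⟩ := Z.exists_integral_functional hd
  have hzero : ∀ k : Z, ∫ ω, (k : Ω →ₘ[μ] ℝ) ω * d ω ∂μ = 0 := by
    intro k
    rw [← hℓ]
    have h1 := ℓ.hasSum (γ.expansion k)
    have h2 : ∀ i, ℓ (γ.coord i k • γ i) = 0 := fun i => by
      rw [map_smul, hℓ, h, smul_zero]
    simp only [h2] at h1
    exact h1.unique hasSum_zero
  obtain ⟨k₀, hk₀⟩ := Z.exists_ae_pos hZ
  have hsm : Measurable (fun ω => if 0 ≤ d ω then (k₀ : Ω →ₘ[μ] ℝ) ω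
      else -(k₀ : Ω →ₘ[μ] ℝ) ω) :=
    Measurable.ite (measurableSet_le measurable_const (AEEqFun.measurable _))
      (AEEqFun.measurable _) (AEEqFun.measurable _).neg
  obtain ⟨k, hk, -⟩ := Z.exists_of_abs_le hsm.aestronglyMeasurable k₀
    (Eventually.of_forall fun ω => by split_ifs <;> simp)
  have h1 : (fun ω => (k : Ω →ₘ[μ] ℝ) ω * d ω) =ᵐ[μ]
      fun ω => (k₀ : Ω →ₘ[μ] ℝ) ω * |d ω| := by
    filter_upwards [hk] with ω h2
    rw [h2]
    split_ifs with h3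
    · rw [abs_of_nonneg h3]
    · rw [abs_of_neg (not_le.1 h3)]; ring
  have h2 := hzero k
  have hint := (mem_kotheSet.1 hd k k.2).congr h1
  rw [integral_congr_ae h1, integral_eq_zero_iff_of_nonneg_ae (by
    filter_upwards [hk₀] with ω h3
    exact mul_nonneg h3.le (abs_nonneg _)) hint] at h2
  apply AEEqFun.ext
  filter_upwards [h2, hk₀, AEEqFun.coeFn_zero (α := Ω) (μ := μ) (β := ℝ)] with ω h3 h4 h5
  rw [h5]
  exact abs_eq_zero.1 ((mul_eq_zero.1 h3).resolve_left h4.ne')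

end ProductNorm

/-! ### Factorization and the inequalities -/

section Factorization

variable {Ω Δ : Type*} [MeasurableSpace Ω] [MeasurableSpace Δ] {μ : Measure Ω} {ν : Measure Δ}
  {X₁ X₂ : BanachFunctionSpace μ} {Y₁ Y₂ : BanachFunctionSpace ν}

theorem mem_multSpace_kotheBidual (hY₁ : Saturated Y₁.carrier) {g : Δ →ₘ[ν] ℝ} :
    g ∈ multSpace Y₂.carrier Y₁.kotheBidual ↔ ∀ (f : Y₂) (k : Y₁.kotheDual hY₁),
      Integrable (fun ω => (f : Δ →ₘ[ν] ℝ) ω * (k : Δ →ₘ[ν] ℝ) ω * g ω) ν := by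
  have h1 : ∀ f k : Δ →ₘ[ν] ℝ, (fun ω => k ω * (f * g : Δ →ₘ[ν] ℝ) ω) =ᵐ[ν]
      fun ω => f ω * k ω * g ω := by
    intro f k
    filter_upwards [AEEqFun.coeFn_mul f g] with ω h
    rw [h, Pi.mul_apply]
    ring
  constructor
  · intro hg f k
    exact (mem_kotheSet.1 (hg f f.2) k k.2).congr (h1 f k)
  · intro hg f hf
    exact mem_kotheSet.2 fun k hk => (hg ⟨f, hf⟩ ⟨k, hk⟩).congr (h1 f k).symm

theorem one_mem_multSpace_iff :
    (1 : Δ →ₘ[ν] ℝ) ∈ multSpace Y₂.carrier Y₁.kotheBidual ↔ Y₂.carrier ≤ Y₁.kotheBidual := by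
  constructor
  · intro h f hf
    simpa using h f hf
  · intro h f hf
    simpa using h hf

theorem mulOp_add (h : multSpace X₁.carrier X₂.carrier) (x y : X₁) :
    mulOp h (x + y) = mulOp h x + mulOp h y := by
  apply Subtype.ext
  apply AEEqFun.ext
  filter_upwards [AEEqFun.coeFn_mul ((x + y : X₁) : Ω →ₘ[μ] ℝ) h, X₁.coeFn_add' x y,
    X₂.coeFn_add' (mulOp h x) (mulOp h y), AEEqFun.coeFn_mul (x : Ω →ₘ[μ] ℝ) h,
    AEEqFun.coeFn_mul (y : Ω →ₘ[μ] ℝ) h] with ω h1 h2 h3 h4 h5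
  simp only [mulOp] at h3 ⊢
  rw [h1, h3, Pi.mul_apply, h2, h4, h5, Pi.mul_apply, Pi.mul_apply, add_mul]

theorem mulOp_smul (h : multSpace X₁.carrier X₂.carrier) (c : ℝ) (x : X₁) :
    mulOp h (c • x) = c • mulOp h x := by
  apply Subtype.ext
  apply AEEqFun.ext
  filter_upwards [AEEqFun.coeFn_mul ((c • x : X₁) : Ω →ₘ[μ] ℝ) h, X₁.coeFn_smul' c x,
    X₂.coeFn_smul' c (mulOp h x), AEEqFun.coeFn_mul (x : Ω →ₘ[μ] ℝ) h] with ω h1 h2 h3 h4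
  simp only [mulOp] at h3 ⊢
  rw [h1, h3, Pi.mul_apply, h2, h4, Pi.mul_apply, mul_assoc]

/-- The linear map `x ↦ R x · k` into the product space. -/
noncomputable def prodLinearMap {E : Type*} [AddCommGroup E] [Module ℝ E] {X Y : BanachFunctionSpace ν}
    (R : E →ₗ[ℝ] X) (k : Y) : E →ₗ[ℝ] prodSpace X Y where
  toFun x := ⟨(R x : Δ →ₘ[ν] ℝ) * (k : Δ →ₘ[ν] ℝ), mul_mem_prodSpace X Y (R x) k⟩
  map_add' x y := by
    apply Subtype.ext
    apply AEEqFun.ext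
    rw [map_add]
    filter_upwards [AEEqFun.coeFn_mul ((R x + R y : X) : Δ →ₘ[ν] ℝ) k, X.coeFn_add' (R x) (R y),
      AEEqFun.coeFn_mul (R x : Δ →ₘ[ν] ℝ) k, AEEqFun.coeFn_mul (R y : Δ →ₘ[ν] ℝ) k,
      AEEqFun.coeFn_add ((R x : Δ →ₘ[ν] ℝ) * (k : Δ →ₘ[ν] ℝ)) ((R y : Δ →ₘ[ν] ℝ) * k)]
      with ω h1 h2 h3 h4 h5
    refine h1.trans (Eq.trans ?_ h5.symm)
    rw [Pi.mul_apply, Pi.add_apply, h2, h3, h4, Pi.mul_apply, Pi.mul_apply, add_mul]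
  map_smul' c x := by
    apply Subtype.ext
    apply AEEqFun.ext
    rw [map_smul]
    filter_upwards [AEEqFun.coeFn_mul ((c • R x : X) : Δ →ₘ[ν] ℝ) k, X.coeFn_smul' c (R x),
      AEEqFun.coeFn_mul (R x : Δ →ₘ[ν] ℝ) k,
      AEEqFun.coeFn_smul c ((R x : Δ →ₘ[ν] ℝ) * (k : Δ →ₘ[ν] ℝ))] with ω h1 h2 h3 h4
    refine h1.trans (Eq.trans ?_ h4.symm)
    rw [Pi.mul_apply, Pi.smul_apply, h2, h3, Pi.mul_apply, smul_eq_mul, mul_assoc]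

/-- The linear functional `x ↦ ∫ T x · k`. -/
noncomputable def pairingLinearMap (hY₁ : Saturated Y₁.carrier) (T : X₁ →L[ℝ] Y₁) (k : Y₁.kotheDual hY₁) :
    X₁ →ₗ[ℝ] ℝ where
  toFun x := ∫ ω, (T x : Δ →ₘ[ν] ℝ) ω * (k : Δ →ₘ[ν] ℝ) ω ∂ν
  map_add' x y := by
    have hk := mem_kotheSet.1 k.2
    rw [← integral_add (hk _ (T x).2) (hk _ (T y).2), map_add]
    apply integral_congr_ae
    filter_upwards [Y₁.coeFn_add' (T x) (T y)] with ω h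
    rw [h, add_mul]
  map_smul' c x := by
    rw [RingHom.id_apply, smul_eq_mul, ← integral_const_mul, map_smul]
    apply integral_congr_ae
    filter_upwards [Y₁.coeFn_smul' c (T x)] with ω h
    rw [h, mul_assoc]

theorem sum_mem_prodSpace (hY₁ : Saturated Y₁.carrier) (S : X₂ →L[ℝ] Y₂)
    (h : multSpace X₁.carrier X₂.carrier) (γ : ℕ → Y₁.kotheDual hY₁) (n : ℕ) (x : ℕ → X₁) :
    ∑ i ∈ Finset.range n, (S (mulOp h (x i)) : Δ →ₘ[ν] ℝ) * (γ i : Δ →ₘ[ν] ℝ)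
      ∈ prodSpace Y₂ (Y₁.kotheDual hY₁) :=
  Submodule.sum_mem _ fun i _ => mul_mem_prodSpace _ _ (S (mulOp h (x i))) (γ i)

/-- With `u = ∑ S(hxᵢ) γᵢ`, the left side is `∫ u g`, and integration against `g` is bounded by the
product norm. -/
theorem BasisInequality.of_factorsStrongly (hY₁ : Saturated Y₁.carrier) {T : X₁ →L[ℝ] Y₁}
    {S : X₂ →L[ℝ] Y₂} {h : multSpace X₁.carrier X₂.carrier} (γ : ℕ → Y₁.kotheDual hY₁)
    (hfac : FactorsStrongly T S h) : BasisInequality hY₁ T S h γ := by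
  obtain ⟨g, hg, hT⟩ := hfac
  have hg' := (mem_multSpace_kotheBidual hY₁).1 hg
  obtain ⟨C, hC, hle⟩ := exists_integral_le_piNorm Y₂ (Y₁.kotheDual hY₁)
    (AEEqFun.aestronglyMeasurable g) hg'
  refine ⟨C, hC, fun n x => le_trans ?_ (hle _ (sum_mem_prodSpace hY₁ S h γ n x))⟩
  rw [← integral_finsetSum _ fun i _ => mem_kotheSet.1 (γ i).2 _ (T (x i)).2]
  refine le_trans (le_of_eq ?_) ((le_abs_self _).trans abs_integral_le_integral_abs)
  apply integral_congr_ae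
  filter_upwards [coeFn_sum_range
      (fun i => (S (mulOp h (x i)) : Δ →ₘ[ν] ℝ) * (γ i : Δ →ₘ[ν] ℝ)) n,
    ae_all_iff.2 fun i => AEEqFun.coeFn_mul (S (mulOp h (x i)) : Δ →ₘ[ν] ℝ) (γ i),
    ae_all_iff.2 fun i => AEEqFun.coeFn_mul g (S (mulOp h (x i)) : Δ →ₘ[ν] ℝ)] with ω h1 h2 h3
  rw [h1, Finset.sum_mul]
  refine Finset.sum_congr rfl fun i _ => ?_
  rw [h2, hT, h3, Pi.mul_apply, Pi.mul_apply]
  ring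

/-- The functional extended from the sums `∑ S(hxᵢ) γᵢ` has a density, and this density is the
multiplier. -/
theorem BasisInequality.factorsStrongly [SigmaFinite ν] (hY₁ : Saturated Y₁.carrier)
    (hY₂ : Saturated Y₂.carrier) {T : X₁ →L[ℝ] Y₁} {S : X₂ →L[ℝ] Y₂}
    {h : multSpace X₁.carrier X₂.carrier} (γ : SchauderBasis ℝ (Y₁.kotheDual hY₁))
    (hcont : Y₂.SigmaOrderContinuous ∨ (Y₁.kotheDual hY₁).SigmaOrderContinuous)
    (hb : BasisInequality hY₁ T S h γ) : FactorsStrongly T S h := by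
  obtain ⟨C, hC, hb⟩ := hb
  have hZ : Saturated (Y₁.kotheDual hY₁).carrier := Y₁.saturated_kotheSet
  let R : X₁ →ₗ[ℝ] Y₂ :=
    { toFun := fun x => S (mulOp h x)
      map_add' := fun x y => by rw [mulOp_add, map_add]
      map_smul' := fun c x => by rw [mulOp_smul, map_smul, RingHom.id_apply] }
  -- Finitely supported families collect the inequalities for all `n` into one linear domination.
  let L : (ℕ →₀ X₁) →ₗ[ℝ] prodSpace Y₂ (Y₁.kotheDual hY₁) :=
    Finsupp.lsum ℝ fun i => prodLinearMap R (γ i)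
  let ψ : (ℕ →₀ X₁) →ₗ[ℝ] ℝ := Finsupp.lsum ℝ fun i => pairingLinearMap hY₁ T (γ i)
  have hsum : ∀ x : ℕ →₀ X₁, ∃ n,
      ψ x = ∑ i ∈ Finset.range n, pairingLinearMap hY₁ T (γ i) (x i) ∧
      L x = ∑ i ∈ Finset.range n, prodLinearMap R (γ i) (x i) := by
    intro x
    obtain ⟨n, hn⟩ := x.support.exists_nat_subset_range
    refine ⟨n, ?_, ?_⟩
    · simp only [ψ, Finsupp.lsum_apply]
      exact Finsupp.sum_of_support_subset _ hn _ fun i _ => map_zero _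
    · simp only [L, Finsupp.lsum_apply]
      exact Finsupp.sum_of_support_subset _ hn _ fun i _ => map_zero _
  obtain ⟨g, hgm, hgint, hg⟩ := exists_density_of_comp_le_piNorm hY₂ hZ hcont L ψ hC.le (by
    intro x
    obtain ⟨n, h1, h2⟩ := hsum x
    rw [h1, h2, Submodule.coe_sum]
    exact hb n x)
  have hG := AEEqFun.coeFn_mk g (hgm.aestronglyMeasurable (μ := ν))
  set G : Δ →ₘ[ν] ℝ := AEEqFun.mk g hgm.aestronglyMeasurable
  have hGint : ∀ (f : Y₂) (k : Y₁.kotheDual hY₁),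
      Integrable (fun ω => (f : Δ →ₘ[ν] ℝ) ω * (k : Δ →ₘ[ν] ℝ) ω * G ω) ν := by
    intro f k
    refine (hgint _ (mul_mem_prodSpace Y₂ (Y₁.kotheDual hY₁) f k)).congr ?_
    filter_upwards [hG, AEEqFun.coeFn_mul (f : Δ →ₘ[ν] ℝ) k] with ω h1 h2
    rw [h1, h2, Pi.mul_apply]
  have hGmem := (mem_multSpace_kotheBidual (Y₂ := Y₂) hY₁).2 hGint
  refine ⟨G, hGmem, fun x => ?_⟩
  -- Both terms lie in `Y₁''`: the first because `Y₁ ⊂ Y₁''`, the second because `G` is a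
  -- multiplier.
  have hd : (T x : Δ →ₘ[ν] ℝ) - (S (mulOp h x) : Δ →ₘ[ν] ℝ) * G
      ∈ kotheSet (Y₁.kotheDual hY₁).carrier := by
    refine Submodule.sub_mem _ (mem_kotheSet.2 fun k hk => ?_) (hGmem _ (S (mulOp h x)).2)
    exact (mem_kotheSet.1 hk _ (T x).2).congr (Eventually.of_forall fun ω => mul_comm _ _)
  have hzero := eq_zero_of_integral_basis_eq_zero hZ γ hd (by
    intro i
    have h1 := hg (Finsupp.single i x)
    have h2 : ψ (Finsupp.single i x) = pairingLinearMap hY₁ T (γ i) x := by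
      simp only [ψ, Finsupp.lsum_single]
    have h3 : L (Finsupp.single i x) = prodLinearMap R (γ i) x := by
      simp only [L, Finsupp.lsum_single]
    rw [h2, h3] at h1
    have h4 : ∫ ω, (prodLinearMap R (γ i) x : Δ →ₘ[ν] ℝ) ω * g ω ∂ν =
        ∫ ω, (S (mulOp h x) : Δ →ₘ[ν] ℝ) ω * (γ i : Δ →ₘ[ν] ℝ) ω * G ω ∂ν := by
      apply integral_congr_ae
      filter_upwards [hG, AEEqFun.coeFn_mul (S (mulOp h x) : Δ →ₘ[ν] ℝ) (γ i)] with ω a1 a2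
      rw [a1]
      congr 1
    have h5 := h1.trans h4
    rw [← sub_eq_zero] at h5
    change (∫ ω, (T x : Δ →ₘ[ν] ℝ) ω * (γ i : Δ →ₘ[ν] ℝ) ω ∂ν) - _ = 0 at h5
    rw [← integral_sub (mem_kotheSet.1 (γ i).2 _ (T x).2) (hGint _ _)] at h5
    rw [← h5]
    apply integral_congr_ae
    filter_upwards [AEEqFun.coeFn_sub (T x : Δ →ₘ[ν] ℝ) ((S (mulOp h x) : Δ →ₘ[ν] ℝ) * G),
      AEEqFun.coeFn_mul (S (mulOp h x) : Δ →ₘ[ν] ℝ) G] with ω a1 a2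
    rw [a1, Pi.sub_apply, a2, Pi.mul_apply]
    ring)
  rw [sub_eq_zero.1 hzero, mul_comm]

theorem abs_sum_eq_sum_abs_of_disjoint {ι : Type*} (s : Finset ι) (a : ι → ℝ)
    (ha : ∀ i j, i ≠ j → a i = 0 ∨ a j = 0) : |∑ i ∈ s, a i| = ∑ i ∈ s, |a i| := by
  by_cases h : ∀ i ∈ s, a i = 0
  · rw [Finset.sum_eq_zero h, Finset.sum_eq_zero fun i hi => by rw [h i hi, abs_zero], abs_zero]
  · push Not at h
    obtain ⟨j, hj, hj0⟩ := h
    have h0 : ∀ i, i ≠ j → a i = 0 := fun i hi => (ha i j hi).resolve_right hj0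
    rw [Finset.sum_eq_single j (fun i _ hi => h0 i hi) fun hn => absurd hj hn,
      Finset.sum_eq_single j (fun i _ hi => by rw [h0 i hi, abs_zero]) fun hn => absurd hj hn]

/-- At almost every point at most one summand is nonzero, so the sum of the integrals of absolute
values is the `L¹` norm of the sum. The inclusion makes `1` a multiplier, and this norm is bounded
by the product norm. -/
theorem SingleTermInequality.basisInequality (hY₁ : Saturated Y₁.carrier) {T : X₁ →L[ℝ] Y₁}
    {S : X₂ →L[ℝ] Y₂} {h : multSpace X₁.carrier X₂.carrier} {γ : ℕ → Y₁.kotheDual hY₁}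
    (hdisj : ∀ i j, i ≠ j → ∀ᵐ ω ∂ν, (γ i : Δ →ₘ[ν] ℝ) ω = 0 ∨ (γ j : Δ →ₘ[ν] ℝ) ω = 0)
    (hsub : Y₂.carrier ≤ Y₁.kotheBidual) (hc : SingleTermInequality hY₁ T S h γ) :
    BasisInequality hY₁ T S h γ := by
  obtain ⟨C, hC, hc⟩ := hc
  have h1 := (mem_multSpace_kotheBidual hY₁).1 (one_mem_multSpace_iff.2 hsub)
  obtain ⟨M, hM, hle⟩ := exists_integral_le_piNorm Y₂ (Y₁.kotheDual hY₁)
    (AEEqFun.aestronglyMeasurable _) h1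
  refine ⟨C * M, by positivity, fun n x => ?_⟩
  have hint : ∀ i, Integrable (fun ω =>
      (S (mulOp h (x i)) : Δ →ₘ[ν] ℝ) ω * (γ i : Δ →ₘ[ν] ℝ) ω) ν := fun i =>
    (mem_kotheSet.1 (hsub (S (mulOp h (x i))).2) (γ i) (γ i).2).congr
      (Eventually.of_forall fun ω => mul_comm _ _)
  calc _ ≤ ∑ i ∈ Finset.range n, C * ∫ ω, |(S (mulOp h (x i)) : Δ →ₘ[ν] ℝ) ω
          * (γ i : Δ →ₘ[ν] ℝ) ω| ∂ν := Finset.sum_le_sum fun i _ => hc i (x i)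
    _ = C * ∫ ω, |(∑ i ∈ Finset.range n, (S (mulOp h (x i)) : Δ →ₘ[ν] ℝ)
          * (γ i : Δ →ₘ[ν] ℝ) : Δ →ₘ[ν] ℝ) ω * (1 : Δ →ₘ[ν] ℝ) ω| ∂ν := by
        rw [← Finset.mul_sum, ← integral_finsetSum _ fun i _ => (hint i).abs]
        congr 1
        apply integral_congr_ae
        have hd : ∀ᵐ ω ∂ν, ∀ i j, i ≠ j →
            (γ i : Δ →ₘ[ν] ℝ) ω = 0 ∨ (γ j : Δ →ₘ[ν] ℝ) ω = 0 := by
          refine ae_all_iff.2 fun i => ae_all_iff.2 fun j => ?_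
          by_cases hij : i = j
          · exact Eventually.of_forall fun ω hne => absurd hij hne
          · filter_upwards [hdisj i j hij] with ω a _ using a
        filter_upwards [hd, coeFn_sum_range
            (fun i => (S (mulOp h (x i)) : Δ →ₘ[ν] ℝ) * (γ i : Δ →ₘ[ν] ℝ)) n,
          ae_all_iff.2 fun i => AEEqFun.coeFn_mul (S (mulOp h (x i)) : Δ →ₘ[ν] ℝ) (γ i),
          AEEqFun.coeFn_one (α := Δ) (μ := ν) (β := ℝ)] with ω a1 a2 a3 a4
        rw [a2, a4, Pi.one_apply, mul_one, abs_sum_eq_sum_abs_of_disjoint]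
        · refine Finset.sum_congr rfl fun i _ => ?_
          rw [a3, Pi.mul_apply]
        · intro i j hij
          rw [a3, a3, Pi.mul_apply, Pi.mul_apply]
          rcases a1 i j hij with b | b
          · exact Or.inl (by rw [b, mul_zero])
          · exact Or.inr (by rw [b, mul_zero])
    _ ≤ C * (M * _) :=
        mul_le_mul_of_nonneg_left (hle _ (sum_mem_prodSpace hY₁ S h γ n x)) hC.le
    _ = _ := (mul_assoc _ _ _).symm

theorem SingleTermInequality.of_factorsStrongly (hY₁ : Saturated Y₁.carrier) {T : X₁ →L[ℝ] Y₁}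
    {S : X₂ →L[ℝ] Y₂} {h : multSpace X₁.carrier X₂.carrier} (γ : ℕ → Y₁.kotheDual hY₁)
    (hsub : Y₂.carrier ≤ Y₁.kotheBidual)
    (hinf : multSpace Y₂.carrier Y₁.kotheBidual ≤ Lp.LpSubmodule ℝ ℝ ∞ ν)
    (hfac : FactorsStrongly T S h) : SingleTermInequality hY₁ T S h γ := by
  obtain ⟨g, hg, hT⟩ := hfac
  obtain ⟨M, hM0, hM⟩ : ∃ M : ℝ, 0 < M ∧ ∀ᵐ ω ∂ν, |g ω| ≤ M := by
    have h1 : MemLp g ∞ ν := Lp.mem_Lp_iff_memLp.1 (hinf hg)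
    have h2 : eLpNormEssSup g ν ≠ ∞ := by
      rw [← eLpNorm_exponent_top]
      exact h1.2.ne
    -- The `+ 1` makes the constant positive even when `g = 0`.
    refine ⟨(eLpNormEssSup g ν).toReal + 1, by positivity, ?_⟩
    filter_upwards [ae_le_eLpNormEssSup (f := g) (μ := ν)] with ω a
    have h3 := ENNReal.toReal_mono h2 a
    rw [toReal_enorm, Real.norm_eq_abs] at h3
    linarith
  refine ⟨M, hM0, fun n x => ?_⟩
  have hint : Integrable (fun ω =>
      (S (mulOp h x) : Δ →ₘ[ν] ℝ) ω * (γ n : Δ →ₘ[ν] ℝ) ω) ν :=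
    (mem_kotheSet.1 (hsub (S (mulOp h x)).2) (γ n) (γ n).2).congr
      (Eventually.of_forall fun ω => mul_comm _ _)
  rw [← integral_const_mul]
  apply integral_mono_ae (mem_kotheSet.1 (γ n).2 _ (T x).2) (hint.abs.const_mul M)
  filter_upwards [hM, AEEqFun.coeFn_mul g (S (mulOp h x) : Δ →ₘ[ν] ℝ)] with ω a1 a2
  rw [hT, a2, Pi.mul_apply, mul_assoc]
  refine (le_abs_self _).trans ?_
  rw [abs_mul]
  exact mul_le_mul_of_nonneg_right a1 (abs_nonneg _)

theorem one_mem_Lp_top : (1 : Δ →ₘ[ν] ℝ) ∈ Lp.LpSubmodule ℝ ℝ ∞ ν := by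
  refine Lp.mem_Lp_iff_memLp.2 ?_
  exact (memLp_top_const (1 : ℝ)).ae_eq AEEqFun.coeFn_one.symm

end Factorization

end BanachFunctionSpace

/-! ### The equivalences -/

theorem theorem4p1 {Ω Δ : Type*} [MeasurableSpace Ω] [MeasurableSpace Δ]
    (μ : Measure Ω) (ν : Measure Δ) [SigmaFinite μ] [SigmaFinite ν]
    (X₁ X₂ : BanachFunctionSpace μ) (Y₁ Y₂ : BanachFunctionSpace ν)
    (hX₁ : BanachFunctionSpace.Saturated X₁.carrier)
    (hX₂ : BanachFunctionSpace.Saturated X₂.carrier)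
    (hY₁ : BanachFunctionSpace.Saturated Y₁.carrier)
    (hY₂ : BanachFunctionSpace.Saturated Y₂.carrier)
    (T : X₁ →L[ℝ] Y₁) (S : X₂ →L[ℝ] Y₂) (hT : T ≠ 0) (hS : S ≠ 0)
    (γ : SchauderBasis ℝ (Y₁.kotheDual hY₁))
    (hsat : BanachFunctionSpace.Saturated (BanachFunctionSpace.multSpace Y₂.carrier Y₁.kotheBidual))
    (hcont : Y₂.SigmaOrderContinuous ∨ (Y₁.kotheDual hY₁).SigmaOrderContinuous)
    (h : BanachFunctionSpace.multSpace X₁.carrier X₂.carrier) :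
    (BanachFunctionSpace.FactorsStrongly T S h ↔ BanachFunctionSpace.BasisInequality hY₁ T S h γ) ∧
    ((∀ i j, i ≠ j → ∀ᵐ ω ∂ν, (γ i : Δ →ₘ[ν] ℝ) ω = 0 ∨ (γ j : Δ →ₘ[ν] ℝ) ω = 0) →
      (Y₂.carrier ≤ Y₁.kotheBidual →
        BanachFunctionSpace.SingleTermInequality hY₁ T S h γ →
          BanachFunctionSpace.FactorsStrongly T S h ∧ BanachFunctionSpace.BasisInequality hY₁ T S h γ) ∧
      (BanachFunctionSpace.multSpace Y₂.carrier Y₁.kotheBidual = Lp.LpSubmodule ℝ ℝ ∞ ν →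
        (BanachFunctionSpace.SingleTermInequality hY₁ T S h γ ↔ BanachFunctionSpace.FactorsStrongly T S h) ∧
        (BanachFunctionSpace.SingleTermInequality hY₁ T S h γ ↔ BanachFunctionSpace.BasisInequality hY₁ T S h γ))) := by
  have hab : BanachFunctionSpace.FactorsStrongly T S h ↔
      BanachFunctionSpace.BasisInequality hY₁ T S h γ :=
    ⟨BanachFunctionSpace.BasisInequality.of_factorsStrongly hY₁ γ,
      BanachFunctionSpace.BasisInequality.factorsStrongly hY₁ hY₂ γ hcont⟩
  refine ⟨hab, fun hdisj => ?_⟩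
  have hcb : Y₂.carrier ≤ Y₁.kotheBidual →
      BanachFunctionSpace.SingleTermInequality hY₁ T S h γ →
      BanachFunctionSpace.BasisInequality hY₁ T S h γ :=
    BanachFunctionSpace.SingleTermInequality.basisInequality hY₁ hdisj
  refine ⟨fun hsub hc => ⟨hab.2 (hcb hsub hc), hcb hsub hc⟩, fun hinf => ?_⟩
  -- The constant `1` is bounded, hence a multiplier, which is the inclusion.
  have hsub : Y₂.carrier ≤ Y₁.kotheBidual := by
    rw [← BanachFunctionSpace.one_mem_multSpace_iff, hinf]
    exact BanachFunctionSpace.one_mem_Lp_top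
  have hac : BanachFunctionSpace.SingleTermInequality hY₁ T S h γ ↔
      BanachFunctionSpace.FactorsStrongly T S h :=
    ⟨fun hc => hab.2 (hcb hsub hc),
      BanachFunctionSpace.SingleTermInequality.of_factorsStrongly hY₁ γ hsub hinf.le⟩
  exact ⟨hac, hac.trans hab⟩
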